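/- Let $H_n=\mathbb C^n\times\mathbb R$ be the Heisenberg group with coordinates $(z,t)$, $z_\beta=x_\beta+iy_\beta$, contact form $\Theta=dt+\sum_\beta(x_\beta dy_\beta-y_\beta dx_\beta)$, contact bundle $\xi=\ker\Theta$, left invariant frame $\mathring e_\beta=\partial_{x_\beta}+y_\beta\partial_t$, $\mathring e_{n+\beta}=\partial_{y_\beta}-x_\beta\partial_t$, $T=\partial_t$, and complex structure $J\mathring e_\beta=\mathring e_{n+\beta}$, $J\mathring e_{n+\beta}=-\mathring e_\beta$ on $\xi$. Its pseudohermitian connection $\nabla$ is the one for which this frame is parallel. Let $(M^{2m+1},\hat J,\hat\theta)$, $m\ge 1$, be a (strictly pseudoconvex) pseudohermitian manifold, smoothly immersed in $H_n$ (for example, embedded) as a pseudohermitian submanifold: $\hat\xi:=\ker\hat\theta=TM\cap\xi$, $\hat J=J|_{\hat\xi}$, $\hat\theta=\Theta|_M$. Its fundamental vector field $\nu$ is the section of $\xi$ along $M$ that is orthogonal to $\hat\xi$ and for which $T+\nu$ is tangent to $M$. Suppose that $M$ is vertical, that is, $\nu\equiv 0$. Then the Reeb field $\hat T$ of $\hat\theta$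 and the pseudohermitian (Tanaka--Webster) connection $\hat\nabla$ of $(M,\hat J,\hat\theta)$ exist, and: (1) the Webster torsion $v\mapsto \mathrm{Tor}_{\hat\nabla}(\hat T,v)$ vanishes identically; (2) on $\hat\xi$, $\hat\nabla$ coincides with the tangential connection $\nabla^t$, the orthogonal projection of $\nabla$ to $\hat\xi$; (3) let $Z_1,\dots,Z_n$ be a Darboux frame, that is, a unitary frame of $\xi_{1,0}$ along $M$ (for the Levi form $-i\,d\Theta(Z,\overline W)$) with $Z_1,\dots,Z_m$ tangent to $M$, and let $h^c_{jk}$, $1\le j,k\le m<c\le n$, be the $Z_c$-component of $\nabla_{Z_k}Z_j$ (the second fundamental form). Then the Webster curvature $R_{j\bar l\zeta\bar\eta}=\langle \hat R(Z_\zeta,Z_{\bar\eta})Z_j,Z_l\rangle$ satisfies the Gauss-like equation $$R_{j\bar l\zeta\bar\eta}=-\sum_{c=m+1}^n h^c_{j\zeta}\,\overline{h^c_{l\eta}},$$ and hence the Webster--Ricci tensor $R_{\zeta\bar\eta}=\sum_{k=1}^m R_{k\bar k\zeta\bar\eta}$ is $$R_{\zeta\bar\eta}=-\sum_{c=m+1}^n\sum_{k=1}^m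 h^c_{k\zeta}\,\overline{h^c_{k\eta}};$$ (4) the Webster--Ricci tensor is non-positive: $R_{Z\bar Z}$ is real and $\le 0$ for every $(1,0)$-vector $Z$ on $M$. -/

import Mathlib

open scoped Manifold ContDiff InnerProductSpace

noncomputable section

/-! ### The Heisenberg group -/

/-- The underlying manifold `ℂⁿ × ℝ` of the Heisenberg group `H_n`, with points `(z, t)`,
`z_β = x_β + i y_β`.  All tangent spaces are identified with `ℂⁿ × ℝ`. -/
abbrev Heis (n : ℕ) : Type := EuclideanSpace ℂ (Fin n) × ℝ

namespace Heis

variable {n : ℕ}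

/-- The contact form `Θ = dt + ∑ (x_β dy_β - y_β dx_β)` at `q = (z, t)`, applied to
`v = (w, s)`; note that `Im (conj z_β * w_β) = x_β Im w_β - y_β Re w_β`. -/
def contactForm (q v : Heis n) : ℝ :=
  v.2 + ∑ β, ((q.1 β).re * (v.1 β).im - (q.1 β).im * (v.1 β).re)

/-- The tangent vector at `q` whose coefficients in the left invariant frame are `c`:
`∑ Re (c_β) e_β + Im (c_β) e_{n+β} + c₀ T`, where `e_β = ∂/∂x_β + y_β ∂/∂t`,
`e_{n+β} = ∂/∂y_β - x_β ∂/∂t`, `T = ∂/∂t`, `c = ((c_β), c₀)`. -/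
def frame (q c : Heis n) : Heis n :=
  (c.1, c.2 + ∑ β, ((c.1 β).re * (q.1 β).im - (c.1 β).im * (q.1 β).re))

/-- The coefficients of a tangent vector `v` at `q` in the left invariant frame
(the inverse of `Heis.frame q`). -/
def coeff (q v : Heis n) : Heis n := (v.1, contactForm q v)

lemma frame_coeff (q v : Heis n) : frame q (coeff q v) = v := by
  refine Prod.ext rfl ?_
  simp only [frame, coeff, contactForm, add_assoc, ← Finset.sum_add_distrib]
  rw [Finset.sum_eq_zero, add_zero]
  intros
  ring

lemma coeff_frame (q c : Heis n) : coeff q (frame q c) = c := by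
  refine Prod.ext rfl ?_
  simp only [frame, coeff, contactForm, add_assoc, ← Finset.sum_add_distrib]
  rw [Finset.sum_eq_zero, add_zero]
  intros
  ring

/-- The complex structure `J` of the contact bundle `ξ = ker Θ` (extended by `J T = 0`):
`J e_β = e_{n+β}`, `J e_{n+β} = - e_β`. -/
def J (q v : Heis n) : Heis n := frame q (Complex.I • v.1, 0)

/-- The characteristic vector field `T = ∂/∂t`. -/
def T (n : ℕ) : Heis n := (0, 1)

/-- The adapted inner product on the contact space at `q`, for which the `e_β`, `e_{n+β}` are
orthonormal (it is one half of the Levi metric `dΘ(·, J ·)`). -/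
def contactInner (v w : Heis n) : ℝ := ⟪v.1, w.1⟫_ℝ

end Heis

/-! ### Pseudohermitian manifolds -/

section Pseudohermitian

/-- The model space of a manifold of dimension `2m+1`. -/
abbrev CRModel (m : ℕ) : Type := EuclideanSpace ℝ (Fin (2 * m + 1))

variable {m : ℕ} {M : Type*} [TopologicalSpace M] [ChartedSpace (CRModel m) M]
  [IsManifold (𝓡 (2 * m + 1)) ∞ M]

/-- Vector fields on `M` (not necessarily smooth). -/
abbrev VField (m : ℕ) (M : Type*) [TopologicalSpace M] [ChartedSpace (CRModel m) M] : Type _ :=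
  (p : M) → TangentSpace (𝓡 (2 * m + 1)) p

/-- Smooth vector fields. -/
def IsSmoothField (X : VField m M) : Prop :=
  ContMDiff (𝓡 (2 * m + 1)) (𝓡 (2 * m + 1)).tangent ∞
    (fun p ↦ (⟨p, X p⟩ : TangentBundle (𝓡 (2 * m + 1)) M))

/-- The derivative `v f` of a function in the direction of a tangent vector. -/
def dirDeriv (f : M → ℝ) (p : M) (v : TangentSpace (𝓡 (2 * m + 1)) p) : ℝ :=
  mfderiv (𝓡 (2 * m + 1)) 𝓘(ℝ, ℝ) f p v

/-- The exterior derivative of a one form: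
`dθ(X, Y) = X θ(Y) - Y θ(X) - θ([X, Y])`. -/
def extd (θ : (p : M) → TangentSpace (𝓡 (2 * m + 1)) p →L[ℝ] ℝ) (X Y : VField m M) (p : M) : ℝ :=
  dirDeriv (fun q ↦ θ q (Y q)) p (X p) - dirDeriv (fun q ↦ θ q (X q)) p (Y p)
    - θ p (VectorField.mlieBracket (𝓡 (2 * m + 1)) X Y p)

variable (m M) in
/-- A (strictly pseudoconvex) pseudohermitian structure `(J, θ)` on a manifold of dimension
`2m+1`. Only the restriction of `J` to the contact bundle `ker θ` is part of the structure;
the values of `J` outside `ker θ` are never used. -/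
structure PseudohermitianStructure where
  /-- the contact form -/
  θ : (p : M) → TangentSpace (𝓡 (2 * m + 1)) p →L[ℝ] ℝ
  /-- the complex structure of the contact bundle -/
  J : (p : M) → TangentSpace (𝓡 (2 * m + 1)) p →L[ℝ] TangentSpace (𝓡 (2 * m + 1)) p
  θ_ne_zero : ∀ p, θ p ≠ 0
  smooth_θ : ∀ X : VField m M, IsSmoothField X →
    ContMDiff (𝓡 (2 * m + 1)) 𝓘(ℝ, ℝ) ∞ (fun p ↦ θ p (X p))
  J_mem : ∀ p v, θ p v = 0 → θ p (J p v) = 0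
  J_sq : ∀ p v, θ p v = 0 → J p (J p v) = -v
  smooth_J : ∀ X : VField m M, IsSmoothField X → (∀ p, θ p (X p) = 0) →
    IsSmoothField (fun p ↦ J p (X p))
  /-- the Levi form is positive definite; in particular `θ` is a contact form -/
  levi_pos : ∀ X : VField m M, IsSmoothField X → (∀ p, θ p (X p) = 0) →
    ∀ p, X p ≠ 0 → 0 < extd θ X (fun q ↦ J q (X q)) p
  /-- integrability of `J`: the bracket `[X, Y] - [JX, JY]` is horizontal -/
  bracket_mem : ∀ X Y : VField m M, IsSmoothField X → IsSmoothField Y →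
    (∀ p, θ p (X p) = 0) → (∀ p, θ p (Y p) = 0) → ∀ p,
    θ p (VectorField.mlieBracket (𝓡 (2 * m + 1)) X Y p
      - VectorField.mlieBracket (𝓡 (2 * m + 1)) (fun q ↦ J q (X q)) (fun q ↦ J q (Y q)) p) = 0
  /-- integrability of `J`: `J ([X, Y] - [JX, JY]) = [JX, Y] + [X, JY]` -/
  integrable : ∀ X Y : VField m M, IsSmoothField X → IsSmoothField Y →
    (∀ p, θ p (X p) = 0) → (∀ p, θ p (Y p) = 0) → ∀ p,
    J p (VectorField.mlieBracket (𝓡 (2 * m + 1)) X Y p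
      - VectorField.mlieBracket (𝓡 (2 * m + 1)) (fun q ↦ J q (X q)) (fun q ↦ J q (Y q)) p)
    = VectorField.mlieBracket (𝓡 (2 * m + 1)) (fun q ↦ J q (X q)) Y p
      + VectorField.mlieBracket (𝓡 (2 * m + 1)) X (fun q ↦ J q (Y q)) p

/-- Affine connections on `M`; `D Y p v` is `∇_v Y` at the point `p`. -/
abbrev AffineConnection (m : ℕ) (M : Type*) [TopologicalSpace M] [ChartedSpace (CRModel m) M]
    [IsManifold (𝓡 (2 * m + 1)) ∞ M] : Type _ :=
  CovariantDerivative (𝓡 (2 * m + 1)) (CRModel m)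
    (TangentSpace (𝓡 (2 * m + 1)) : M → Type _)

/-- The curvature `R(X, Y) V = ∇_X ∇_Y V - ∇_Y ∇_X V - ∇_{[X, Y]} V`. -/
def curvature (D : AffineConnection m M)
    (X Y V : VField m M) : VField m M := fun p ↦
  D (fun q ↦ D V q (Y q)) p (X p) - D (fun q ↦ D V q (X q)) p (Y p)
    - D V p (VectorField.mlieBracket (𝓡 (2 * m + 1)) X Y p)

namespace PseudohermitianStructure

variable (S : PseudohermitianStructure m M)

/-- Sections of the contact bundle `ker θ`. -/
def IsHorizontal (X : VField m M) : Prop := ∀ p, S.θ p (X p) = 0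

/-- The vector field `J X`. -/
def JField (X : VField m M) : VField m M := fun p ↦ S.J p (X p)

/-- `T` is the Reeb field of `θ`: `θ(T) = 1` and `dθ(T, ·) = 0`. -/
structure IsReebField (T : VField m M) : Prop where
  smooth : IsSmoothField T
  θ_eq_one : ∀ p, S.θ p (T p) = 1
  extd_eq_zero : ∀ X : VField m M, IsSmoothField X → ∀ p, extd S.θ T X p = 0

/-- The hermitian Levi form `-i dθ(Z_V, conj Z_W) = (dθ(V, JW) - i dθ(V, W)) / 2` of the
`(1,0)`-fields `Z_V = (V - i JV) / 2`, `Z_W = (W - i JW) / 2`, for horizontal `V` and `W`. -/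
def levi (V W : VField m M) (p : M) : ℂ :=
  ((extd S.θ V (S.JField W) p : ℂ) - Complex.I * (extd S.θ V W p : ℂ)) / 2

/-- The `m` vectors `Z_j = (E_j - i J E_j) / 2` form a unitary basis of the
`(1,0)`-vectors at `p`, for the Levi form. -/
structure IsUnitaryFrameAt (p : M) (E : Fin m → VField m M) : Prop where
  smooth : ∀ j, IsSmoothField (E j)
  horizontal : ∀ j, S.IsHorizontal (E j)
  unitary : ∀ j k, S.levi (E j) (E k) p = if j = k then 1 else 0

/-- `D` is the pseudohermitian (Tanaka-Webster) connection of `(M, J, θ)`, where `T` is the Reeb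
field: the contact bundle, `T`, `J` and `dθ` are parallel, the torsion of two horizontal vectors
is `dθ(X, Y) T`, and `X ↦ Tor(T, X)` anticommutes with `J`. -/
structure IsPseudohermitianConnection (T : VField m M) (D : AffineConnection m M) : Prop where
  smooth : ∀ X Y : VField m M, IsSmoothField X → IsSmoothField Y →
    IsSmoothField (fun p ↦ D Y p (X p))
  horizontal : ∀ Y : VField m M, IsSmoothField Y → S.IsHorizontal Y →
    ∀ p v, S.θ p (D Y p v) = 0
  reeb_parallel : ∀ p v, D T p v = 0
  J_parallel : ∀ Y : VField m M, IsSmoothField Y → S.IsHorizontal Y →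
    ∀ p v, D (S.JField Y) p v = S.J p (D Y p v)
  metric : ∀ X Y Z : VField m M, IsSmoothField X → IsSmoothField Y → IsSmoothField Z →
    S.IsHorizontal Y → S.IsHorizontal Z → ∀ p,
    dirDeriv (fun q ↦ extd S.θ Y Z q) p (X p)
      = extd S.θ (fun q ↦ D Y q (X q)) Z p + extd S.θ Y (fun q ↦ D Z q (X q)) p
  torsion_horizontal : ∀ X Y : VField m M, IsSmoothField X → IsSmoothField Y →
    S.IsHorizontal X → S.IsHorizontal Y → ∀ p,
    D.torsion p (X p) (Y p) = extd S.θ X Y p • T p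
  torsion_reeb : ∀ p v, S.θ p v = 0 →
    D.torsion p (T p) (S.J p v) = - S.J p (D.torsion p (T p) v)

/-- The Webster curvature `R_{V \bar W X \bar Y} = ⟨R(Z_X, conj Z_Y) Z_V, Z_W⟩`, where
`Z_X = (X - i JX) / 2` and `conj Z_Y = (Y + i JY) / 2`: it is the complex bilinear extension in
the first two slots of `(X, Y) ↦ ⟨R(X, Y) V, W⟩`, evaluated at these complex vectors. -/
def websterCurvature (D : AffineConnection m M) (V W X Y : VField m M) (p : M) : ℂ :=
  (S.levi (curvature D X Y V) W p + S.levi (curvature D (S.JField X) (S.JField Y) V) W p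
    + Complex.I * (S.levi (curvature D X (S.JField Y) V) W p
      - S.levi (curvature D (S.JField X) Y V) W p)) / 4

/-- The Webster-Ricci tensor `R_{X \bar Y} = ∑_k R_{k \bar k X \bar Y}`, computed in a frame `E`
that is unitary at `p`. -/
def websterRicci (D : AffineConnection m M) (E : Fin m → VField m M) (X Y : VField m M)
    (p : M) : ℂ :=
  ∑ k, S.websterCurvature D (E k) (E k) X Y p

end PseudohermitianStructure

/-! ### Pseudohermitian submanifolds of the Heisenberg group -/

variable {n : ℕ}

/-- The differential of `ι : M → H_n`. -/
def pushforward (ι : M → Heis n) (p : M) : TangentSpace (𝓡 (2 * m + 1)) p →L[ℝ] Heis n :=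
  mfderiv (𝓡 (2 * m + 1)) 𝓘(ℝ, Heis n) ι p

namespace PseudohermitianStructure

variable (S : PseudohermitianStructure m M)

/-- `ι` makes `(M, J, θ)` a pseudohermitian submanifold of `H_n`. -/
structure IsPseudohermitianSubmanifold (ι : M → Heis n) : Prop where
  smooth : ContMDiff (𝓡 (2 * m + 1)) 𝓘(ℝ, Heis n) ∞ ι
  immersion : ∀ p, Function.Injective (pushforward (m := m) ι p)
  contact : ∀ p v, S.θ p v = 0 ↔ Heis.contactForm (ι p) (pushforward ι p v) = 0
  complex : ∀ p v, S.θ p v = 0 →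
    pushforward ι p (S.J p v) = Heis.J (ι p) (pushforward ι p v)
  form : ∀ p v, S.θ p v = Heis.contactForm (ι p) (pushforward ι p v)

/-- `ν` is the fundamental vector field: the horizontal field of `H_n` along `M` that is
orthogonal to the contact bundle of `M` and for which `T + ν` is tangent to `M`. -/
structure IsFundamentalVectorField (ι : M → Heis n) (ν : M → Heis n) : Prop where
  horizontal : ∀ p, Heis.contactForm (ι p) (ν p) = 0
  orthogonal : ∀ p v, S.θ p v = 0 → Heis.contactInner (pushforward ι p v) (ν p) = 0
  tangent : ∀ p, ∃ v : TangentSpace (𝓡 (2 * m + 1)) p, pushforward ι p v = Heis.T n + ν p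

/-- The submanifold is vertical if its fundamental vector field vanishes identically. -/
def IsVertical (ι : M → Heis n) : Prop := S.IsFundamentalVectorField ι (fun _ ↦ 0)

end PseudohermitianStructure

/-- The pseudohermitian connection of `H_n`, for a vector field `W` of `H_n` along `ι`. It is the
connection for which the left invariant frame `e_β`, `e_{n+β}`, `T` is parallel. -/
def heisDeriv (ι : M → Heis n) (W : M → Heis n) (p : M)
    (v : TangentSpace (𝓡 (2 * m + 1)) p) : Heis n :=
  Heis.frame (ι p)
    (mfderiv (𝓡 (2 * m + 1)) 𝓘(ℝ, Heis n) (fun q ↦ Heis.coeff (ι q) (W q)) p v : Heis n)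

namespace PseudohermitianStructure

variable (S : PseudohermitianStructure m M)

/-- The image of the contact space of `M` at `p` under the differential of `ι`, in the
coefficients `ℂⁿ` of the contact space of `H_n` with respect to the left invariant frame. -/
def contactSubspace (ι : M → Heis n) (p : M) : Submodule ℝ (EuclideanSpace ℂ (Fin n)) :=
  (LinearMap.ker (S.θ p : TangentSpace (𝓡 (2 * m + 1)) p →ₗ[ℝ] ℝ)).map
    ((LinearMap.fst ℝ (EuclideanSpace ℂ (Fin n)) ℝ).comp
      (pushforward (m := m) ι p).toLinearMap)

/-- The tangential connection on the contact bundle of `M`, with values in the contact bundle of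
`M` regarded as a subbundle of that of `H_n`: the orthogonal projection of the pseudohermitian
derivative in `H_n` onto the contact space of `M`. -/
def tangentialDeriv (ι : M → Heis n) (Y : VField m M) (p : M)
    (v : TangentSpace (𝓡 (2 * m + 1)) p) : Heis n :=
  Heis.frame (ι p)
    ((S.contactSubspace ι p).starProjection
      (heisDeriv ι (fun q ↦ pushforward ι q (Y q)) p v).1, 0)

/-- A Darboux frame at `p`: the vectors `Z_j = (E_j - i J E_j) / 2`, `j = 1, …, m`, tangent to
`M`, together with the normal vectors `Z_a = ∑_β N_a^β (e_β - i e_{n+β}) / 2`,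
`a = m+1, …, n`, form a unitary basis of the `(1,0)`-vectors of `H_n`. -/
structure IsDarbouxFrameAt (ι : M → Heis n) (p : M) (E : Fin m → VField m M)
    (N : Fin (n - m) → EuclideanSpace ℂ (Fin n)) : Prop where
  smooth : ∀ j, IsSmoothField (E j)
  horizontal : ∀ j, S.IsHorizontal (E j)
  unitary : Orthonormal ℂ (Sum.elim (fun j ↦ (pushforward ι p (E j p)).1) N)

/-- The value at `v` of the connection form `θ_j^a` of `H_n`: the coefficient of `Z_a` in
`∇_v Z_j`, where `Z_j = (X - i JX) / 2`. -/
def connectionForm (ι : M → Heis n) (Na : EuclideanSpace ℂ (Fin n)) (X : VField m M) (p : M)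
    (v : TangentSpace (𝓡 (2 * m + 1)) p) : ℂ :=
  ⟪Na, (heisDeriv ι (fun q ↦ pushforward ι q (X q)) p v).1⟫_ℂ

/-- The coefficient `h^a_{jk} = II^a(Z_j, Z_k) = θ_j^a(Z_k)` of the second fundamental form, for
`Z_j = (X - i JX) / 2` and `Z_k = (Y - i JY) / 2`. -/
def secondFundamentalForm (ι : M → Heis n) (Na : EuclideanSpace ℂ (Fin n)) (X Y : VField m M)
    (p : M) : ℂ :=
  (connectionForm ι Na X p (Y p)
    - Complex.I * connectionForm ι Na X p (S.J p (Y p))) / 2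

end PseudohermitianStructure

end Pseudohermitian

end

/-! Verticality says that `T` is tangent to `M`, so the projection `φ = z ∘ ι : M → ℂⁿ` collapses
the Reeb direction. On `ker θ` the differential `dφ` is injective and complex linear, and `θ = dt +
Im⟨z, dz⟩` gives `dθ(X, Y) = 2 Im⟨dφ X, dφ Y⟩`. Thus `φ(M)` is locally a complex submanifold of flat
`ℂⁿ`, and the pseudohermitian geometry of `M` is its induced Kähler geometry. `IsVerticalProjection`
records these properties, and all the geometry is derived from them.

A tangent vector is determined by its pair `(dφ, θ)`. Existence of the connection: project the flat
derivative of `dφ Y` orthogonally to the range of `dφ`; the torsion is then `dθ ⊗ T`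
(`torsion_connection`). Uniqueness: on horizontal fields a Koszul argument identifies any
pseudohermitian connection with this projection (`proj_fieldDeriv_connection`). Along `T` the
torsion must both commute and anticommute with `J`, hence vanishes (`torsion_reeb_eq_zero_and`).

The difference of the flat derivative and `D` is a normal-valued form `II`, symmetric and complex
bilinear on horizontal fields. Flatness of `ℂⁿ` and the Weingarten relation express the curvature
through products of two values of `II`. Passing to type (1,1) leaves `-⟨II(Y, W), II(X, V)⟩`
(`websterCurvature_eq`). Expanding in a Darboux frame gives the Gauss equation, and the Ricci trace
is minus a sum of squared norms. -/

noncomputable section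

/-! ### Calculus of vector-valued functions on a manifold; derivative along a Lie bracket -/

section VectorValued

open Bundle VectorField

variable {E : Type*} [NormedAddCommGroup E] [NormedSpace ℝ E]
  {H : Type*} [TopologicalSpace H] {I : ModelWithCorners ℝ E H}
  {M : Type*} [TopologicalSpace M] [ChartedSpace H M]
  {F : Type*} [NormedAddCommGroup F] [NormedSpace ℝ F]
  {F' : Type*} [NormedAddCommGroup F'] [NormedSpace ℝ F']

lemma mvfderiv_fderiv_comp_apply {f : M → F} {g : F → F'} {p : M} (hg : DifferentiableAt ℝ g (f p))
    (hf : MDifferentiableAt I 𝓘(ℝ, F) f p) (v : TangentSpace I p) :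
    mvfderiv I (fun q ↦ g (f q)) p v = fderiv ℝ g (f p) (mvfderiv I f p v) := by
  have h := mfderiv_comp p hg.mdifferentiableAt hf
  rw [mfderiv_eq_fderiv] at h
  exact congrArg (fun L : E →L[ℝ] F' ↦ L v) h

lemma mvfderiv_clm_apply (L : F →L[ℝ] F') {f : M → F} {p : M}
    (hf : MDifferentiableAt I 𝓘(ℝ, F) f p) (v : TangentSpace I p) :
    mvfderiv I (fun q ↦ L (f q)) p v = L (mvfderiv I f p v) := by
  rw [mvfderiv_fderiv_comp_apply (g := L) L.differentiableAt hf, L.fderiv]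

lemma mvfderiv_prodMk {f : M → F} {g : M → F'} {p : M}
    (hf : MDifferentiableAt I 𝓘(ℝ, F) f p) (hg : MDifferentiableAt I 𝓘(ℝ, F') g p)
    (v : TangentSpace I p) :
    mvfderiv I (fun q ↦ (f q, g q)) p v = (mvfderiv I f p v, mvfderiv I g p v) := by
  have h := hf.prodMk_space hg
  refine Prod.ext ?_ ?_
  · exact (mvfderiv_clm_apply (ContinuousLinearMap.fst ℝ F F') h v).symm
  · exact (mvfderiv_clm_apply (ContinuousLinearMap.snd ℝ F F') h v).symm

lemma mvfderiv_inner {V : Type*} [NormedAddCommGroup V] [InnerProductSpace ℂ V]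
    [NormedSpace ℝ V] [IsScalarTower ℝ ℂ V] {f g : M → V} {p : M}
    (hf : MDifferentiableAt I 𝓘(ℝ, V) f p) (hg : MDifferentiableAt I 𝓘(ℝ, V) g p)
    (v : TangentSpace I p) :
    mvfderiv I (fun q ↦ ⟪f q, g q⟫_ℂ) p v
      = ⟪mvfderiv I f p v, g p⟫_ℂ + ⟪f p, mvfderiv I g p v⟫_ℂ := by
  have h : HasFDerivAt (fun x : V × V ↦ ⟪x.1, x.2⟫_ℂ) _ (f p, g p) :=
    (hasFDerivAt_fst (𝕜 := ℝ)).inner ℂ hasFDerivAt_snd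
  rw [mvfderiv_fderiv_comp_apply (g := fun x : V × V ↦ ⟪x.1, x.2⟫_ℂ) (f := fun q ↦ (f q, g q))
    h.differentiableAt (hf.prodMk_space hg), h.fderiv, mvfderiv_prodMk hf hg]
  simp [fderivInnerCLM_apply, add_comm]

lemma MDifferentiableAt.inner_complex {V : Type*} [NormedAddCommGroup V] [InnerProductSpace ℂ V]
    [NormedSpace ℝ V] [IsScalarTower ℝ ℂ V] {f g : M → V} {p : M}
    (hf : MDifferentiableAt I 𝓘(ℝ, V) f p) (hg : MDifferentiableAt I 𝓘(ℝ, V) g p) :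
    MDifferentiableAt I 𝓘(ℝ, ℂ) (fun q ↦ ⟪f q, g q⟫_ℂ) p := by
  have h : HasFDerivAt (fun x : V × V ↦ ⟪x.1, x.2⟫_ℂ) _ (f p, g p) :=
    (hasFDerivAt_fst (𝕜 := ℝ)).inner ℂ hasFDerivAt_snd
  exact h.differentiableAt.mdifferentiableAt.comp p (hf.prodMk_space hg)

lemma ContMDiffAt.inner_complex {V : Type*} [NormedAddCommGroup V] [InnerProductSpace ℂ V]
    [NormedSpace ℝ V] [IsScalarTower ℝ ℂ V] {f g : M → V} {p : M} {k : ℕ∞ω}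
    (hf : ContMDiffAt I 𝓘(ℝ, V) k f p) (hg : ContMDiffAt I 𝓘(ℝ, V) k g p) :
    ContMDiffAt I 𝓘(ℝ, ℂ) k (fun q ↦ ⟪f q, g q⟫_ℂ) p := by
  have h : ContDiff ℝ k (fun x : V × V ↦ ⟪x.1, x.2⟫_ℂ) :=
    (contDiff_fst (𝕜 := ℝ)).inner ℂ contDiff_snd
  exact h.contMDiff.contMDiffAt.comp p (hf.prodMk_space hg)

lemma mvfderiv_eq_fderiv_comp_extChartAt_symm [I.Boundaryless] {f : M → F} {p : M}
    (hf : MDifferentiableAt I 𝓘(ℝ, F) f p) (v : TangentSpace I p) :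
    mvfderiv I f p v = fderiv ℝ (f ∘ (extChartAt I p).symm) (extChartAt I p p) v := by
  have h := hf.mfderiv
  rw [I.range_eq_univ, fderivWithin_univ] at h
  exact congrArg (fun L : E →L[ℝ] F ↦ L v) h

variable [IsManifold I ∞ M]

lemma ContMDiffAt.mvfderiv_vectorField {f : M → F} (hf : ContMDiff I 𝓘(ℝ, F) ∞ f)
    {X : Π p : M, TangentSpace I p} {p : M}
    (hX : ContMDiffAt I I.tangent ∞ (fun q ↦ (⟨q, X q⟩ : TangentBundle I M)) p) :
    ContMDiffAt I 𝓘(ℝ, F) ∞ (fun q ↦ mvfderiv I f q (X q)) p := by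
  have h := (hf.contMDiff_tangentMap (m := ∞) le_rfl).contMDiffAt.comp p hX
  exact (contMDiff_snd_tangentBundle_modelSpace F 𝓘(ℝ, F)).contMDiffAt.comp p h

lemma MDifferentiableAt.mvfderiv_vectorField {f : M → F} (hf : ContMDiff I 𝓘(ℝ, F) ∞ f)
    {X : Π p : M, TangentSpace I p} {p : M}
    (hX : MDifferentiableAt I I.tangent (fun q ↦ (⟨q, X q⟩ : TangentBundle I M)) p) :
    MDifferentiableAt I 𝓘(ℝ, F) (fun q ↦ mvfderiv I f q (X q)) p := by
  have h := ((hf.contMDiff_tangentMap (m := ∞) le_rfl).mdifferentiable (by simp) _).comp p hX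
  exact ((contMDiff_snd_tangentBundle_modelSpace F 𝓘(ℝ, F) (n := ∞)).mdifferentiable
    (by simp) _).comp p h

variable [I.Boundaryless]

/-- Pulling `X` back to the chart applies the inverse of the derivative of the inverse chart, which
the chain rule cancels. -/
lemma fderiv_comp_extChartAt_symm_mpullbackWithin {f : M → F} {p : M} {y : E}
    (hy : y ∈ (extChartAt I p).target)
    (hf : MDifferentiableAt I 𝓘(ℝ, F) f ((extChartAt I p).symm y))
    (X : Π p : M, TangentSpace I p) :
    fderiv ℝ (f ∘ (extChartAt I p).symm) y
      (mpullbackWithin 𝓘(ℝ, E) I (extChartAt I p).symm X (Set.range I) y)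
      = mvfderiv I f ((extChartAt I p).symm y) (X ((extChartAt I p).symm y)) := by
  have h1 := mdifferentiableWithinAt_extChartAt_symm hy
  have hinv := isInvertible_mfderivWithin_extChartAt_symm hy
  have h2 : ((mfderivWithin 𝓘(ℝ, E) I (extChartAt I p).symm (Set.range I) y).comp
      (mfderivWithin 𝓘(ℝ, E) I (extChartAt I p).symm (Set.range I) y).inverse)
      (X ((extChartAt I p).symm y)) = X ((extChartAt I p).symm y) := by
    rw [hinv.self_comp_inverse]; rfl
  rw [I.range_eq_univ] at h1 h2
  rw [mfderivWithin_univ] at h2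
  rw [mdifferentiableWithinAt_univ] at h1
  have h3 := mfderiv_comp y hf h1
  rw [mfderiv_eq_fderiv] at h3
  rw [mpullbackWithin_apply, I.range_eq_univ, mfderivWithin_univ]
  refine (congrArg (fun L : E →L[ℝ] F ↦ L _) h3).trans ?_
  exact congrArg (mvfderiv I f ((extChartAt I p).symm y)) h2

variable [CompleteSpace E]

/-- In a chart this is the symmetry of the second derivative of `f`. Applied to `φ` it controls
torsion; applied to the derivative of `φ` along a field it expresses the flatness of `ℂⁿ`. -/
theorem mvfderiv_mlieBracket {f : M → F} (hf : ContMDiff I 𝓘(ℝ, F) ∞ f)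
    {X Y : Π p : M, TangentSpace I p} {p : M}
    (hX : MDifferentiableAt I I.tangent (fun q ↦ (⟨q, X q⟩ : TangentBundle I M)) p)
    (hY : MDifferentiableAt I I.tangent (fun q ↦ (⟨q, Y q⟩ : TangentBundle I M)) p) :
    mvfderiv I f p (mlieBracket I X Y p)
      = mvfderiv I (fun q ↦ mvfderiv I f q (Y q)) p (X p)
        - mvfderiv I (fun q ↦ mvfderiv I f q (X q)) p (Y p) := by
  have hfd : ∀ q, MDifferentiableAt I 𝓘(ℝ, F) f q := hf.mdifferentiable (by simp)
  set φ := extChartAt I p with hφ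
  set X' : E → E := mpullbackWithin 𝓘(ℝ, E) I φ.symm X (Set.range I) with hX'
  set Y' : E → E := mpullbackWithin 𝓘(ℝ, E) I φ.symm Y (Set.range I) with hY'
  have hXd : DifferentiableAt ℝ X' (φ p) := by
    have := hX.mdifferentiableWithinAt (s := Set.univ)
      |>.differentiableWithinAt_mpullbackWithin_vectorField
    rw [Set.preimage_univ, Set.univ_inter, I.range_eq_univ] at this
    rw [hX', I.range_eq_univ]
    exact differentiableWithinAt_univ.1 this
  have hYd : DifferentiableAt ℝ Y' (φ p) := by
    have := hY.mdifferentiableWithinAt (s := Set.univ)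
      |>.differentiableWithinAt_mpullbackWithin_vectorField
    rw [Set.preimage_univ, Set.univ_inter, I.range_eq_univ] at this
    rw [hY', I.range_eq_univ]
    exact differentiableWithinAt_univ.1 this
  have hg : ContDiffAt ℝ ∞ (f ∘ φ.symm) (φ p) := by
    have := (contMDiffAt_iff (n := ∞)).1 (hf p) |>.2
    simpa [I.range_eq_univ, contDiffWithinAt_univ] using! this
  have hbr : mlieBracket I X Y p = lieBracket ℝ X' Y' (φ p) := by
    -- The preferred chart at `p` has identity derivative at `p` in the tangent coordinates, so the
    -- bracket at `p` is the one computed in the chart.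
    have h1 : ∀ (L : E →L[ℝ] E) (w : E), L = ContinuousLinearMap.id ℝ E → L.inverse w = w := by
      rintro _ w rfl
      rw [ContinuousLinearMap.inverse_id]
      rfl
    have h2 : lieBracketWithin ℝ X' Y' (φ.symm ⁻¹' Set.univ ∩ Set.range I) (φ p)
        = lieBracket ℝ X' Y' (φ p) := by
      rw [Set.preimage_univ, Set.univ_inter, I.range_eq_univ, lieBracketWithin_univ]
    rw [← mlieBracketWithin_univ, mlieBracketWithin_apply]
    exact (h1 _ _ mfderiv_extChartAt_self).trans h2
  have key : ∀ (Z W : Π p : M, TangentSpace I p),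
      MDifferentiableAt I I.tangent (fun q ↦ (⟨q, Z q⟩ : TangentBundle I M)) p →
      fderiv ℝ (fun y ↦ fderiv ℝ (f ∘ φ.symm) y
        (mpullbackWithin 𝓘(ℝ, E) I φ.symm Z (Set.range I) y)) (φ p)
        (mpullbackWithin 𝓘(ℝ, E) I φ.symm W (Set.range I) (φ p))
      = mvfderiv I (fun q ↦ mvfderiv I f q (Z q)) p (W p) := by
    intro Z W hZ
    have h1 : (fun y ↦ fderiv ℝ (f ∘ φ.symm) y
        (mpullbackWithin 𝓘(ℝ, E) I φ.symm Z (Set.range I) y)) =ᶠ[nhds (φ p)]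
        ((fun q ↦ mvfderiv I f q (Z q)) ∘ φ.symm) := by
      filter_upwards [extChartAt_target_mem_nhds p] with y hy
      exact fderiv_comp_extChartAt_symm_mpullbackWithin hy (hfd _) Z
    have h2 : φ.symm (φ p) = p := extChartAt_to_inv p
    have h3 := fderiv_comp_extChartAt_symm_mpullbackWithin (I := I)
      (f := fun q ↦ mvfderiv I f q (Z q)) (mem_extChartAt_target p)
      (by rw [extChartAt_to_inv]; exact hZ.mvfderiv_vectorField hf) W
    rw [h1.fderiv_eq, h3, extChartAt_to_inv]
  rw [mvfderiv_eq_fderiv_comp_extChartAt_symm (hfd p), hbr]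
  refine (fderiv_apply_lieBracket hg (by simpa using WithTop.coe_le_coe.2 (le_top : (2 : ℕ∞) ≤ ⊤)) hYd hXd).trans ?_
  rw [key Y X hY, key X Y hX]

end VectorValued

end

/-! ### Constructing smooth vector fields -/

noncomputable section

section SmoothFields

open Bundle

variable {E : Type*} [NormedAddCommGroup E] [NormedSpace ℝ E]
  {H : Type*} [TopologicalSpace H] {I : ModelWithCorners ℝ E H}
  {M : Type*} [TopologicalSpace M] [ChartedSpace H M]
  {K : Type*} [NormedAddCommGroup K] [InnerProductSpace ℝ K]

lemma ContMDiffAt.matrix_det {ι : Type*} [Fintype ι] [DecidableEq ι] {k : ℕ∞ω}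
    {G : M → Matrix ι ι ℝ} {p : M} (h : ∀ i j, ContMDiffAt I 𝓘(ℝ, ℝ) k (fun q ↦ G q i j) p) :
    ContMDiffAt I 𝓘(ℝ, ℝ) k (fun q ↦ (G q).det) p := by
  simp only [Matrix.det_apply']
  refine ContMDiffAt.sum fun σ _ ↦ ?_
  exact contMDiffAt_const.mul (ContMDiffAt.prod fun i _ ↦ h _ _)

variable [FiniteDimensional ℝ E]

/-- The extension through a trivialization is smooth only near `p`; a bump function supported there
makes it global. This lets axioms stated for smooth fields be applied to single tangent vectors. -/
lemma exists_contMDiff_vectorField_eq [T2Space M] [IsManifold I ∞ M] {p : M}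
    (v : TangentSpace I p) :
    ∃ X : Π q : M, TangentSpace I q,
      ContMDiff I I.tangent ∞ (fun q ↦ (⟨q, X q⟩ : TangentBundle I M)) ∧ X p = v := by
  obtain ⟨s, hs, hsv⟩ := FiberBundle.exists_contMDiffOn_extend (k := ∞) I E v
  obtain ⟨u, hus, hu, hpu⟩ := mem_nhds_iff.1 hs
  obtain ⟨f, hf, -⟩ := (SmoothBumpFunction.nhds_basis_support (I := I)
    (hu.mem_nhds hpu)).mem_iff.1 (hu.mem_nhds hpu)
  refine ⟨(f : M → ℝ) • FiberBundle.extend E v, ?_, ?_⟩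
  · exact ContMDiffOn.smul_section_of_tsupport f.contMDiff.contMDiffOn hu hf (hsv.mono hus)
  · simp

variable [IsManifold I ∞ M]

/-- A vector field is smooth as soon as its image under a smooth injective bundle map to a
constant inner product space is the orthogonal projection of a smooth function. -/
theorem contMDiffAt_vectorField_of_inner_eq (A : Π p : M, TangentSpace I p →ₗ[ℝ] K)
    (hinj : ∀ p, Function.Injective (A p))
    (hA : ∀ (X : Π q : M, TangentSpace I q) (p : M),
      ContMDiffAt I I.tangent ∞ (fun q ↦ (⟨q, X q⟩ : TangentBundle I M)) p →
      ContMDiffAt I 𝓘(ℝ, K) ∞ (fun q ↦ A q (X q)) p)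
    {u : Π q : M, TangentSpace I q} {w : M → K} {p : M} (hw : ContMDiffAt I 𝓘(ℝ, K) ∞ w p)
    (h : ∀ q v, ⟪A q v, A q (u q)⟫_ℝ = ⟪A q v, w q⟫_ℝ) :
    ContMDiffAt I I.tangent ∞ (fun q ↦ (⟨q, u q⟩ : TangentBundle I M)) p := by
  set e := trivializationAt E (TangentSpace I : M → Type _) p
  set b := Module.finBasis ℝ E
  have hs := e.isLocalFrameOn_localFrame_baseSet I ∞ b
  have he : e.baseSet ∈ nhds p :=
    e.open_baseSet.mem_nhds (FiberBundle.mem_baseSet_trivializationAt' p)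
  set s := e.localFrame b
  have hsm : ∀ i, ContMDiffAt I 𝓘(ℝ, K) ∞ (fun q ↦ A q (s i q)) p := fun i ↦
    hA _ _ ((hs.contMDiffOn i).contMDiffAt he)
  -- The coefficients of `u` in the local frame solve the linear system with this Gram matrix and
  -- right-hand side `r`. By Cramer's rule they are quotients of smooth determinants.
  set G : M → Matrix _ _ ℝ := fun q ↦ Matrix.gram ℝ (fun i ↦ A q (s i q))
  set r : M → _ → ℝ := fun q i ↦ ⟪A q (s i q), w q⟫_ℝ
  have hG : ∀ i j, ContMDiffAt I 𝓘(ℝ, ℝ) ∞ (fun q ↦ G q i j) p := fun i j ↦ by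
    have := (contDiff_inner (E := K) (𝕜 := ℝ) (n := ∞)).contMDiff.contMDiffAt.comp p
      ((hsm i).prodMk_space (hsm j))
    exact this
  have hr : ∀ i, ContMDiffAt I 𝓘(ℝ, ℝ) ∞ (fun q ↦ r q i) p := fun i ↦ by
    have := (contDiff_inner (E := K) (𝕜 := ℝ) (n := ∞)).contMDiff.contMDiffAt.comp p
      ((hsm i).prodMk_space hw)
    exact this
  have hdet : ∀ q ∈ e.baseSet, (G q).det ≠ 0 := fun q hq ↦ by
    rw [Matrix.det_gram_ne_zero_iff_linearIndependent]
    exact (hs.linearIndependent hq).map' (A q) (LinearMap.ker_eq_bot.2 (hinj q))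
  refine hs.contMDiffAt_of_coeff (fun i ↦ ?_) he
  have hc : ∀ᶠ q in nhds p, (LinearMap.piApply (hs.coeff i)) u q
      = ((G q).det)⁻¹ * ((G q).updateCol i (r q)).det := by
    filter_upwards [he] with q hq
    have h1 : u q = ∑ j, hs.coeff j q (u q) • s j q := hs.coeff_sum_eq u hq
    have h2 : (G q).mulVec (fun j ↦ hs.coeff j q (u q)) = r q := by
      ext j
      have h3 := h q (s j q)
      rw [h1] at h3
      simp only [map_sum, map_smul, inner_sum, inner_smul_right] at h3
      simp only [Matrix.mulVec, dotProduct, G, r, Matrix.gram_apply, ← h3, mul_comm]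
    have h4 := congrFun ((G q).cramer_eq_adjugate_mulVec (r q)) i
    rw [Matrix.cramer_apply, ← h2, Matrix.mulVec_mulVec, Matrix.adjugate_mul,
      Matrix.smul_mulVec, Matrix.one_mulVec, h2, Pi.smul_apply, smul_eq_mul] at h4
    rw [h4, inv_mul_cancel_left₀ (hdet q hq)]
    rfl
  refine ContMDiffAt.congr_of_eventuallyEq ?_ hc
  refine ((ContMDiffAt.matrix_det hG).inv₀
    (hdet p (FiberBundle.mem_baseSet_trivializationAt' p))).mul (ContMDiffAt.matrix_det ?_)
  intro j k
  by_cases hk : k = i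
  · subst hk
    simpa using hr j
  · simpa [Matrix.updateCol_ne hk] using hG j k

end SmoothFields

end

/-! ### Derivatives along vector fields of `M` -/

noncomputable section

section FieldDeriv

variable {m n : ℕ} {M : Type*} [TopologicalSpace M] [ChartedSpace (CRModel m) M]
  {F : Type*} [NormedAddCommGroup F] [NormedSpace ℝ F]

/-- The derivative `X f` of a vector valued function along a vector field. -/
def fieldDeriv (f : M → F) (X : VField m M) (p : M) : F := mvfderiv (𝓡 (2 * m + 1)) f p (X p)

lemma dirDeriv_eq_mvfderiv (f : M → ℝ) (p : M) (v : TangentSpace (𝓡 (2 * m + 1)) p) :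
    dirDeriv f p v = mvfderiv (𝓡 (2 * m + 1)) f p v := rfl

variable [IsManifold (𝓡 (2 * m + 1)) ∞ M]

lemma IsSmoothField.mdifferentiableAt {X : VField m M} (hX : IsSmoothField X) (p : M) :
    MDifferentiableAt (𝓡 (2 * m + 1)) (𝓡 (2 * m + 1)).tangent
      (fun q ↦ (⟨q, X q⟩ : TangentBundle (𝓡 (2 * m + 1)) M)) p :=
  ContMDiff.mdifferentiable hX (by simp) p

lemma IsSmoothField.contMDiff_fieldDeriv {X : VField m M} (hX : IsSmoothField X) {f : M → F}
    (hf : ContMDiff (𝓡 (2 * m + 1)) 𝓘(ℝ, F) ∞ f) :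
    ContMDiff (𝓡 (2 * m + 1)) 𝓘(ℝ, F) ∞ (fieldDeriv f X) := fun p ↦
  ContMDiffAt.mvfderiv_vectorField hf (hX p)

lemma MDifferentiableAt.fieldDeriv {X : VField m M} {p : M}
    (hX : MDifferentiableAt (𝓡 (2 * m + 1)) (𝓡 (2 * m + 1)).tangent
      (fun q ↦ (⟨q, X q⟩ : TangentBundle (𝓡 (2 * m + 1)) M)) p) {f : M → F}
    (hf : ContMDiff (𝓡 (2 * m + 1)) 𝓘(ℝ, F) ∞ f) :
    MDifferentiableAt (𝓡 (2 * m + 1)) 𝓘(ℝ, F) (fieldDeriv f X) p :=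
  hX.mvfderiv_vectorField hf

lemma IsSmoothField.mdifferentiableAt_fieldDeriv {X : VField m M} (hX : IsSmoothField X)
    {f : M → F} (hf : ContMDiff (𝓡 (2 * m + 1)) 𝓘(ℝ, F) ∞ f) (p : M) :
    MDifferentiableAt (𝓡 (2 * m + 1)) 𝓘(ℝ, F) (fieldDeriv f X) p :=
  (hX.contMDiff_fieldDeriv hf).mdifferentiable (by simp) p

lemma mvfderiv_mlieBracket_eq_fieldDeriv {f : M → F}
    (hf : ContMDiff (𝓡 (2 * m + 1)) 𝓘(ℝ, F) ∞ f) {X Y : VField m M} (hX : IsSmoothField X)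
    (hY : IsSmoothField Y) (p : M) :
    mvfderiv (𝓡 (2 * m + 1)) f p (VectorField.mlieBracket (𝓡 (2 * m + 1)) X Y p)
      = fieldDeriv (fieldDeriv f Y) X p - fieldDeriv (fieldDeriv f X) Y p :=
  mvfderiv_mlieBracket hf (hX.mdifferentiableAt p) (hY.mdifferentiableAt p)

lemma exists_isSmoothField_eq [T2Space M] {p : M} (v : TangentSpace (𝓡 (2 * m + 1)) p) :
    ∃ X : VField m M, IsSmoothField X ∧ X p = v :=
  exists_contMDiff_vectorField_eq v

end FieldDeriv

/-! ### Projections to `ℂⁿ` that collapse the Reeb direction -/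

section VerticalProjection

variable {m n : ℕ} {M : Type*} [TopologicalSpace M] [ChartedSpace (CRModel m) M]

/-- The image of the differential of a map to `ℂⁿ`. -/
def derivRange (φ : M → EuclideanSpace ℂ (Fin n)) (p : M) :
    Submodule ℝ (EuclideanSpace ℂ (Fin n)) :=
  LinearMap.range (mvfderiv (𝓡 (2 * m + 1)) φ p).toLinearMap

namespace PseudohermitianStructure.IsVerticalProjection

lemma mem_derivRange (φ : M → EuclideanSpace ℂ (Fin n)) {p : M}
    (v : TangentSpace (𝓡 (2 * m + 1)) p) :
    mvfderiv (𝓡 (2 * m + 1)) φ p v ∈ derivRange (m := m) φ p := ⟨v, rfl⟩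

lemma fieldDeriv_mem_derivRange (φ : M → EuclideanSpace ℂ (Fin n)) (X : VField m M) (p : M) :
    fieldDeriv φ X p ∈ derivRange (m := m) φ p := ⟨X p, rfl⟩

lemma real_inner_eq_re (x y : EuclideanSpace ℂ (Fin n)) : ⟪x, y⟫_ℝ = (⟪x, y⟫_ℂ).re := by
  simp [PiLp.inner_apply]

variable {φ : M → EuclideanSpace ℂ (Fin n)}

/-- The orthogonal projection of `ℂⁿ` to the image of the differential. -/
def proj (m : ℕ) {M : Type*} [TopologicalSpace M] [ChartedSpace (CRModel m) M]
    (φ : M → EuclideanSpace ℂ (Fin n)) (p : M) :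
    EuclideanSpace ℂ (Fin n) →L[ℝ] EuclideanSpace ℂ (Fin n) :=
  (derivRange (m := m) φ p).starProjection

lemma proj_mem (p : M) (x : EuclideanSpace ℂ (Fin n)) : proj m φ p x ∈ derivRange (m := m) φ p :=
  Submodule.starProjection_apply_mem _ _

lemma proj_of_mem {p : M} {x : EuclideanSpace ℂ (Fin n)} (hx : x ∈ derivRange (m := m) φ p) :
    proj m φ p x = x :=
  Submodule.starProjection_eq_self_iff.2 hx

lemma real_inner_proj {p : M} {w : EuclideanSpace ℂ (Fin n)}
    (hw : w ∈ derivRange (m := m) φ p) (x : EuclideanSpace ℂ (Fin n)) :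
    ⟪w, proj m φ p x⟫_ℝ = ⟪w, x⟫_ℝ := by
  have h := Submodule.starProjection_inner_eq_zero (K := derivRange (m := m) φ p) x w hw
  rw [inner_sub_left, sub_eq_zero] at h
  rw [real_inner_comm, real_inner_comm _ w]
  exact h.symm

lemma eq_zero_of_real_inner {p : M} {w : EuclideanSpace ℂ (Fin n)}
    (hw : w ∈ derivRange (m := m) φ p)
    (h : ∀ w' ∈ derivRange (m := m) φ p, ⟪w', w⟫_ℝ = 0) : w = 0 :=
  inner_self_eq_zero.1 (h w hw)

end PseudohermitianStructure.IsVerticalProjection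

variable [IsManifold (𝓡 (2 * m + 1)) ∞ M]

namespace PseudohermitianStructure

variable (S : PseudohermitianStructure m M)

/-- A smooth map to `ℂⁿ` that is holomorphic and immersive along the contact bundle, contracts
a transverse direction, and pulls back the Kähler form to a multiple of `dθ`. -/
structure IsVerticalProjection (φ : M → EuclideanSpace ℂ (Fin n)) : Prop where
  smooth : ContMDiff (𝓡 (2 * m + 1)) 𝓘(ℝ, EuclideanSpace ℂ (Fin n)) ∞ φ
  complex : ∀ p v, S.θ p v = 0 →
    mvfderiv (𝓡 (2 * m + 1)) φ p (S.J p v) = Complex.I • mvfderiv (𝓡 (2 * m + 1)) φ p v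
  injective : ∀ p v, S.θ p v = 0 → mvfderiv (𝓡 (2 * m + 1)) φ p v = 0 → v = 0
  exists_transverse : ∀ p, ∃ v, S.θ p v = 1 ∧ mvfderiv (𝓡 (2 * m + 1)) φ p v = 0
  -- The field `smooth_θ` speaks of globally smooth fields. Local frames, and the axioms of a
  -- covariant derivative, need regularity at a single point.
  contMDiffAt_θ : ∀ (X : VField m M) (p : M),
    ContMDiffAt (𝓡 (2 * m + 1)) (𝓡 (2 * m + 1)).tangent ∞
      (fun q ↦ (⟨q, X q⟩ : TangentBundle (𝓡 (2 * m + 1)) M)) p →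
    ContMDiffAt (𝓡 (2 * m + 1)) 𝓘(ℝ, ℝ) ∞ (fun q ↦ S.θ q (X q)) p
  mdifferentiableAt_θ : ∀ (X : VField m M) (p : M),
    MDifferentiableAt (𝓡 (2 * m + 1)) (𝓡 (2 * m + 1)).tangent
      (fun q ↦ (⟨q, X q⟩ : TangentBundle (𝓡 (2 * m + 1)) M)) p →
    MDifferentiableAt (𝓡 (2 * m + 1)) 𝓘(ℝ, ℝ) (fun q ↦ S.θ q (X q)) p
  extd_eq : ∀ X Y : VField m M, IsSmoothField X → IsSmoothField Y → ∀ p,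
    extd S.θ X Y p = 2 * (⟪fieldDeriv φ X p, fieldDeriv φ Y p⟫_ℂ).im

namespace IsVerticalProjection

variable {S} {φ : M → EuclideanSpace ℂ (Fin n)}

section

variable (hφ : S.IsVerticalProjection φ)
include hφ

/-- The difference is horizontal and killed by `dφ`. Identities between tangent vectors are checked
below through these two components. -/
lemma ext {p : M} {u v : TangentSpace (𝓡 (2 * m + 1)) p} (hθ : S.θ p u = S.θ p v)
    (h : mvfderiv (𝓡 (2 * m + 1)) φ p u = mvfderiv (𝓡 (2 * m + 1)) φ p v) : u = v := by
  rw [← sub_eq_zero]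
  exact hφ.injective p _ (by rw [map_sub, hθ, sub_self]) (by rw [map_sub, h, sub_self])

/-- Adding a multiple of the collapsed transverse vector adjusts `θ` freely without changing `dφ`.
-/
lemma exists_eq {p : M} {w : EuclideanSpace ℂ (Fin n)} (hw : w ∈ derivRange (m := m) φ p)
    (c : ℝ) : ∃ v : TangentSpace (𝓡 (2 * m + 1)) p,
      S.θ p v = c ∧ mvfderiv (𝓡 (2 * m + 1)) φ p v = w := by
  obtain ⟨v, rfl⟩ := hw
  obtain ⟨t, ht, ht'⟩ := hφ.exists_transverse p
  refine ⟨v + (c - S.θ p v) • t, ?_, ?_⟩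
  · simp [ht]
  · simp [ht']

/-- Each vector of the range has a horizontal preimage, to which `J` applies. -/
lemma I_smul_mem {p : M} {w : EuclideanSpace ℂ (Fin n)} (hw : w ∈ derivRange (m := m) φ p) :
    Complex.I • w ∈ derivRange (m := m) φ p := by
  obtain ⟨v, hv, rfl⟩ := hφ.exists_eq hw 0
  exact ⟨S.J p v, hφ.complex p v hv⟩

end

section

variable (hφ : S.IsVerticalProjection φ)
include hφ

/-- The range is a complex subspace, so the real orthogonal projection is also the hermitian one:
testing against `i w` recovers the imaginary part. -/
lemma inner_proj {p : M} {w : EuclideanSpace ℂ (Fin n)}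
    (hw : w ∈ derivRange (m := m) φ p) (x : EuclideanSpace ℂ (Fin n)) :
    ⟪w, proj m φ p x⟫_ℂ = ⟪w, x⟫_ℂ := by
  have h1 := real_inner_proj hw x
  have h2 := real_inner_proj (hφ.I_smul_mem hw) x
  rw [real_inner_eq_re, real_inner_eq_re] at h1 h2
  rw [inner_smul_left, inner_smul_left] at h2
  apply Complex.ext h1
  simpa using h2

lemma inner_proj_left {p : M} {w : EuclideanSpace ℂ (Fin n)}
    (hw : w ∈ derivRange (m := m) φ p) (x : EuclideanSpace ℂ (Fin n)) :
    ⟪proj m φ p x, w⟫_ℂ = ⟪x, w⟫_ℂ := by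
  rw [← inner_conj_symm, hφ.inner_proj hw, inner_conj_symm]

lemma proj_I_smul (p : M) (x : EuclideanSpace ℂ (Fin n)) :
    proj m φ p (Complex.I • x) = Complex.I • proj m φ p x := by
  rw [← sub_eq_zero]
  refine eq_zero_of_real_inner (m := m) (φ := φ) (p := p)
    (Submodule.sub_mem _ (proj_mem _ _) (hφ.I_smul_mem (proj_mem _ _))) fun w hw ↦ ?_
  rw [real_inner_eq_re, inner_sub_right, hφ.inner_proj hw, inner_smul_right, inner_smul_right,
    hφ.inner_proj hw, sub_self, Complex.zero_re]

/-- The Gram matrix criterion for the injective bundle map `(dφ, θ)`. It supplies smoothness of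
fields that are chosen point by point. -/
lemma isSmoothField_of_proj {u : VField m M} {w : M → EuclideanSpace ℂ (Fin n)} {c : M → ℝ}
    (hw : ContMDiff (𝓡 (2 * m + 1)) 𝓘(ℝ, EuclideanSpace ℂ (Fin n)) ∞ w)
    (hc : ContMDiff (𝓡 (2 * m + 1)) 𝓘(ℝ, ℝ) ∞ c) (hθ : ∀ p, S.θ p (u p) = c p)
    (h : ∀ p, fieldDeriv φ u p = proj m φ p (w p)) : IsSmoothField u := by
  intro p
  -- The plain product has the sup norm; the criterion needs the inner product of the `L²` product.
  set L := (WithLp.prodContinuousLinearEquiv 2 ℝ (EuclideanSpace ℂ (Fin n)) ℝ).symm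
  refine contMDiffAt_vectorField_of_inner_eq
    (K := WithLp 2 (EuclideanSpace ℂ (Fin n) × ℝ))
    (A := fun q ↦ L.toLinearMap ∘ₗ
      ((mvfderiv (𝓡 (2 * m + 1)) φ q).toLinearMap.prod (S.θ q).toLinearMap))
    (w := fun q ↦ L (w q, c q)) ?_ ?_ ?_ ?_
  · intro q u v huv
    have h1 := L.injective huv
    exact hφ.ext (congrArg Prod.snd h1) (congrArg Prod.fst h1)
  · intro X q hX
    exact L.contDiff.contMDiff.contMDiffAt.comp q
      ((ContMDiffAt.mvfderiv_vectorField hφ.smooth hX).prodMk_space (hφ.contMDiffAt_θ X q hX))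
  · exact L.contDiff.contMDiff.contMDiffAt.comp p ((hw p).prodMk_space (hc p))
  · intro q v
    rw [WithLp.prod_inner_apply, WithLp.prod_inner_apply]
    have h1 := real_inner_proj (mem_derivRange φ v) (w q)
    rw [← h q] at h1
    refine congrArg₂ (· + ·) h1 ?_
    change ⟪S.θ q v, S.θ q (u q)⟫_ℝ = ⟪S.θ q v, c q⟫_ℝ
    rw [hθ q]

end

end IsVerticalProjection

end PseudohermitianStructure

end VerticalProjection

end

/-! ### Existence of the Reeb field and of the pseudohermitian connection -/

noncomputable section

section VerticalConnection

open Bundle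

variable {m n : ℕ} {M : Type*} [TopologicalSpace M] [ChartedSpace (CRModel m) M]

namespace PseudohermitianStructure.IsVerticalProjection

lemma mvfderiv_I_smul {f : M → EuclideanSpace ℂ (Fin n)} {p : M}
    (hf : MDifferentiableAt (𝓡 (2 * m + 1)) 𝓘(ℝ, EuclideanSpace ℂ (Fin n)) f p)
    (v : TangentSpace (𝓡 (2 * m + 1)) p) :
    mvfderiv (𝓡 (2 * m + 1)) (fun q ↦ Complex.I • f q) p v
      = Complex.I • mvfderiv (𝓡 (2 * m + 1)) f p v :=
  mvfderiv_clm_apply (Complex.I • ContinuousLinearMap.id ℝ (EuclideanSpace ℂ (Fin n))) hf v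

variable [IsManifold (𝓡 (2 * m + 1)) ∞ M]

variable {S : PseudohermitianStructure m M} {φ : M → EuclideanSpace ℂ (Fin n)}

lemma isReebField (hφ : S.IsVerticalProjection φ) {T : VField m M}
    (hθ : ∀ p, S.θ p (T p) = 1) (hT : ∀ p, fieldDeriv φ T p = 0) : S.IsReebField T := by
  have hs : IsSmoothField T := hφ.isSmoothField_of_proj (w := 0) (c := 1) contMDiff_const
    contMDiff_const hθ fun p ↦ by rw [hT p, Pi.zero_apply, map_zero]
  refine ⟨hs, hθ, fun X hX p ↦ ?_⟩
  rw [hφ.extd_eq T X hs hX, hT p, inner_zero_left, Complex.zero_im, mul_zero]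

lemma exists_isReebField (hφ : S.IsVerticalProjection φ) :
    ∃ T : VField m M, S.IsReebField T ∧ ∀ p, fieldDeriv φ T p = 0 := by
  choose T hT hT' using hφ.exists_transverse
  exact ⟨T, hφ.isReebField hT hT', hT'⟩

/-- Testing `dθ(T, ·) = 0` on a field whose image at `p` is `i dφ(T)` gives `2 |dφ(T)|² = 0`. -/
lemma fieldDeriv_reeb [T2Space M] (hφ : S.IsVerticalProjection φ) {T : VField m M}
    (hT : S.IsReebField T) (p : M) : fieldDeriv φ T p = 0 := by
  obtain ⟨v, -, hv⟩ := hφ.exists_eq (hφ.I_smul_mem (mem_derivRange φ (T p))) 0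
  obtain ⟨X, hX, rfl⟩ := exists_isSmoothField_eq v
  have h := hT.extd_eq_zero X hX p
  have hX' : fieldDeriv φ X p = Complex.I • fieldDeriv φ T p := hv
  rw [hφ.extd_eq T X hT.smooth hX, hX', inner_smul_right] at h
  rw [← inner_self_eq_zero (𝕜 := ℝ), real_inner_eq_re]
  simpa using h

/-- A linear choice of the preimages from `exists_eq`, so that the connection built from it is
linear in the direction. -/
lemma exists_lift (hφ : S.IsVerticalProjection φ) (p : M) :
    ∃ G : EuclideanSpace ℂ (Fin n) × ℝ →L[ℝ] TangentSpace (𝓡 (2 * m + 1)) p,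
      ∀ x, S.θ p (G x) = x.2 ∧ mvfderiv (𝓡 (2 * m + 1)) φ p (G x) = proj m φ p x.1 := by
  set A : TangentSpace (𝓡 (2 * m + 1)) p →ₗ[ℝ] EuclideanSpace ℂ (Fin n) × ℝ :=
    (mvfderiv (𝓡 (2 * m + 1)) φ p).toLinearMap.prod (S.θ p).toLinearMap
  have hA : Function.Injective A := fun u v h ↦
    hφ.ext (congrArg Prod.snd h) (congrArg Prod.fst h)
  obtain ⟨L, hL⟩ := A.exists_leftInverse_of_injective (LinearMap.ker_eq_bot.2 hA)
  refine ⟨LinearMap.toContinuousLinearMap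
    (L ∘ₗ (proj m φ p).toLinearMap.prodMap LinearMap.id), fun x ↦ ?_⟩
  obtain ⟨v, hv, hv'⟩ := hφ.exists_eq (proj_mem (m := m) (φ := φ) p x.1) x.2
  have h : L (proj m φ p x.1, x.2) = v := by
    rw [← hv, ← hv']
    exact congrArg (fun l ↦ l v) hL
  change S.θ p (L (proj m φ p x.1, x.2)) = _ ∧
    mvfderiv (𝓡 (2 * m + 1)) φ p (L (proj m φ p x.1, x.2)) = _
  rw [h]
  exact ⟨hv, hv'⟩

/-- The map inverting `(dφ, θ)`, after orthogonal projection to its image. -/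
def lift (hφ : S.IsVerticalProjection φ) (p : M) :
    EuclideanSpace ℂ (Fin n) × ℝ →L[ℝ] TangentSpace (𝓡 (2 * m + 1)) p :=
  (hφ.exists_lift p).choose

/-- The projection of the flat derivative, as a family of linear maps. -/
def connectionFun (hφ : S.IsVerticalProjection φ) (Y : VField m M) (p : M) :
    TangentSpace (𝓡 (2 * m + 1)) p →L[ℝ] TangentSpace (𝓡 (2 * m + 1)) p :=
  (hφ.lift p).comp ((mvfderiv (𝓡 (2 * m + 1)) (fieldDeriv φ Y) p).prod
    (mvfderiv (𝓡 (2 * m + 1)) (fun q ↦ S.θ q (Y q)) p))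

lemma θ_connectionFun (hφ : S.IsVerticalProjection φ) (Y : VField m M) (p : M)
    (v : TangentSpace (𝓡 (2 * m + 1)) p) :
    S.θ p (hφ.connectionFun Y p v)
      = mvfderiv (𝓡 (2 * m + 1)) (fun q ↦ S.θ q (Y q)) p v :=
  ((hφ.exists_lift p).choose_spec _).1

lemma mvfderiv_connectionFun (hφ : S.IsVerticalProjection φ) (Y : VField m M) (p : M)
    (v : TangentSpace (𝓡 (2 * m + 1)) p) :
    mvfderiv (𝓡 (2 * m + 1)) φ p (hφ.connectionFun Y p v)
      = proj m φ p (mvfderiv (𝓡 (2 * m + 1)) (fieldDeriv φ Y) p v) :=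
  ((hφ.exists_lift p).choose_spec _).2

/-- The connection obtained from the flat connection of `ℂⁿ` by orthogonal projection. -/
def connection (hφ : S.IsVerticalProjection φ) : AffineConnection m M where
  toFun := hφ.connectionFun
  isCovariantDerivativeOnUniv :=
    { add := by
        intro σ σ' p hσ hσ' _
        refine ContinuousLinearMap.ext fun v ↦ hφ.ext ?_ ?_
        · rw [add_apply, map_add]
          simp only [θ_connectionFun, Pi.add_apply, map_add]
          rw [mvfderiv_fun_add (hφ.mdifferentiableAt_θ σ p hσ) (hφ.mdifferentiableAt_θ σ' p hσ')]
          rfl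
        · rw [add_apply, map_add]
          simp only [mvfderiv_connectionFun, ← map_add]
          have h : fieldDeriv φ (σ + σ') = fieldDeriv φ σ + fieldDeriv φ σ' :=
            funext fun q ↦ map_add _ _ _
          rw [h, mvfderiv_add (MDifferentiableAt.fieldDeriv hσ hφ.smooth)
            (MDifferentiableAt.fieldDeriv hσ' hφ.smooth)]
          rfl
      leibniz := by
        intro σ g p hσ hg _
        refine ContinuousLinearMap.ext fun v ↦ hφ.ext ?_ ?_
        · rw [add_apply, map_add]
          have h : (fun q ↦ S.θ q ((g • σ) q)) = g • fun q ↦ S.θ q (σ q) :=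
            funext fun q ↦ (S.θ q).map_smul (g q) (σ q)
          rw [θ_connectionFun, h, mvfderiv_smul hg (hφ.mdifferentiableAt_θ σ p hσ)]
          simp [θ_connectionFun]
        · rw [add_apply, map_add]
          have h : fieldDeriv φ (g • σ) = g • fieldDeriv φ σ :=
            
            funext fun q ↦ (mvfderiv (𝓡 (2 * m + 1)) φ q).map_smul (g q) (σ q)
          rw [mvfderiv_connectionFun, h,
            mvfderiv_smul hg (MDifferentiableAt.fieldDeriv hσ hφ.smooth)]
          -- The Leibniz term is a multiple of `dφ σ`, which lies in the range and so survives
          -- projection.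
          have h' : proj m φ p (fieldDeriv φ σ p) = fieldDeriv φ σ p :=
            proj_of_mem (mem_derivRange φ (σ p))
          simp [mvfderiv_connectionFun, h']
          rfl }

lemma θ_connection (hφ : S.IsVerticalProjection φ) (Y : VField m M) (p : M)
    (v : TangentSpace (𝓡 (2 * m + 1)) p) :
    S.θ p (hφ.connection Y p v) = mvfderiv (𝓡 (2 * m + 1)) (fun q ↦ S.θ q (Y q)) p v :=
  hφ.θ_connectionFun Y p v

lemma mvfderiv_connection (hφ : S.IsVerticalProjection φ) (Y : VField m M) (p : M)
    (v : TangentSpace (𝓡 (2 * m + 1)) p) :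
    mvfderiv (𝓡 (2 * m + 1)) φ p (hφ.connection Y p v)
      = proj m φ p (mvfderiv (𝓡 (2 * m + 1)) (fieldDeriv φ Y) p v) :=
  hφ.mvfderiv_connectionFun Y p v

lemma fieldDeriv_JField (hφ : S.IsVerticalProjection φ) {Y : VField m M} (hY : S.IsHorizontal Y) :
    fieldDeriv φ (S.JField Y) = fun q ↦ Complex.I • fieldDeriv φ Y q :=
  funext fun q ↦ hφ.complex q (Y q) (hY q)

lemma mvfderiv_fieldDeriv_JField (hφ : S.IsVerticalProjection φ) {Y : VField m M}
    (hs : IsSmoothField Y) (hY : S.IsHorizontal Y) (p : M)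
    (v : TangentSpace (𝓡 (2 * m + 1)) p) :
    mvfderiv (𝓡 (2 * m + 1)) (fieldDeriv φ (S.JField Y)) p v
      = Complex.I • mvfderiv (𝓡 (2 * m + 1)) (fieldDeriv φ Y) p v := by
  rw [hφ.fieldDeriv_JField hY, mvfderiv_I_smul (hs.mdifferentiableAt_fieldDeriv hφ.smooth p)]

lemma mvfderiv_θ_of_isHorizontal {Y : VField m M} (hY : S.IsHorizontal Y) (p : M)
    (v : TangentSpace (𝓡 (2 * m + 1)) p) :
    mvfderiv (𝓡 (2 * m + 1)) (fun q ↦ S.θ q (Y q)) p v = 0 := by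
  have h : (fun q ↦ S.θ q (Y q)) = fun _ ↦ (0 : ℝ) := funext hY
  rw [h, mvfderiv_const, zero_apply]

lemma isSmoothField_connection (hφ : S.IsVerticalProjection φ) {X Y : VField m M}
    (hX : IsSmoothField X) (hY : IsSmoothField Y) :
    IsSmoothField (fun p ↦ hφ.connection Y p (X p)) := by
  have hθ : ContMDiff (𝓡 (2 * m + 1)) 𝓘(ℝ, ℝ) ∞ (fun q ↦ S.θ q (Y q)) := S.smooth_θ Y hY
  exact hφ.isSmoothField_of_proj (w := fieldDeriv (fieldDeriv φ Y) X)
    (c := fieldDeriv (fun q ↦ S.θ q (Y q)) X)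
    (hX.contMDiff_fieldDeriv (hY.contMDiff_fieldDeriv hφ.smooth)) (hX.contMDiff_fieldDeriv hθ)
    (fun p ↦ hφ.θ_connection Y p (X p)) (fun p ↦ hφ.mvfderiv_connection Y p (X p))

/-- The torsion of the projected connection is `dθ ⊗ T`. -/
lemma torsion_connection (hφ : S.IsVerticalProjection φ) {T : VField m M}
    (hT : S.IsReebField T) (hT' : ∀ p, fieldDeriv φ T p = 0) {X Y : VField m M}
    (hX : IsSmoothField X) (hY : IsSmoothField Y) (p : M) :
    hφ.connection.torsion p (X p) (Y p) = extd S.θ X Y p • T p := by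
  rw [hφ.connection.torsion_apply (hX.mdifferentiableAt p) (hY.mdifferentiableAt p)]
  refine hφ.ext ?_ ?_
  · rw [map_sub, map_sub, map_smul, hT.θ_eq_one, θ_connection, θ_connection]
    simp [extd, dirDeriv_eq_mvfderiv]
  · rw [map_sub, map_sub, map_smul, mvfderiv_connection, mvfderiv_connection, ← map_sub]
    -- The commutator of flat derivatives is `dφ [X, Y]`, already in the range. Hence the torsion
    -- has no `dφ` component.
    have h := mvfderiv_mlieBracket_eq_fieldDeriv hφ.smooth hX hY p
    have h' := proj_of_mem (mem_derivRange φ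
      (VectorField.mlieBracket (𝓡 (2 * m + 1)) X Y p))
    rw [h] at h'
    rw [h, show mvfderiv (𝓡 (2 * m + 1)) φ p (T p) = 0 from hT' p, smul_zero, sub_eq_zero]
    exact h'

/-- `dθ` is parallel by the product rule for the hermitian product, since the projection may be
dropped against vectors of the range. `J` is parallel because the projection is complex linear.
Torsion `dθ ⊗ T` makes `Tor(T, ·)` zero, so it anticommutes with `J` trivially. -/
lemma isPseudohermitianConnection [T2Space M] (hφ : S.IsVerticalProjection φ) {T : VField m M}
    (hT : S.IsReebField T) (hT' : ∀ p, fieldDeriv φ T p = 0) :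
    S.IsPseudohermitianConnection T hφ.connection where
  smooth X Y hX hY := hφ.isSmoothField_connection hX hY
  horizontal Y _ hY p v := by rw [θ_connection, mvfderiv_θ_of_isHorizontal hY]
  reeb_parallel p v := by
    refine hφ.ext ?_ ?_
    · have h : (fun q ↦ S.θ q (T q)) = fun _ ↦ (1 : ℝ) := funext hT.θ_eq_one
      rw [θ_connection, h, mvfderiv_const, map_zero, zero_apply]
    · have h : fieldDeriv φ T = fun _ ↦ 0 := funext hT'
      rw [mvfderiv_connection, h, mvfderiv_const, map_zero, zero_apply, map_zero]
  J_parallel Y hs hY p v := by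
    have hh : S.θ p (hφ.connection Y p v) = 0 := by
      rw [θ_connection, mvfderiv_θ_of_isHorizontal hY]
    refine hφ.ext ?_ ?_
    · rw [S.J_mem p _ hh, θ_connection, 
        mvfderiv_θ_of_isHorizontal (Y := S.JField Y) fun q ↦ S.J_mem q _ (hY q)]
    · rw [mvfderiv_connection, hφ.mvfderiv_fieldDeriv_JField hs hY, hφ.proj_I_smul,
        hφ.complex p _ hh, mvfderiv_connection]
  metric X Y Z hX hY hZ _ _ p := by
    have hYd := hY.mdifferentiableAt_fieldDeriv hφ.smooth p
    have hZd := hZ.mdifferentiableAt_fieldDeriv hφ.smooth p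
    have h1 : (fun q ↦ extd S.θ Y Z q)
        = fun q ↦ ((2 : ℝ) • Complex.imCLM) ⟪fieldDeriv φ Y q, fieldDeriv φ Z q⟫_ℂ :=
      funext fun q ↦ hφ.extd_eq Y Z hY hZ q
    rw [dirDeriv_eq_mvfderiv, h1, mvfderiv_clm_apply _ (hYd.inner_complex hZd),
      mvfderiv_inner hYd hZd, hφ.extd_eq _ _ (hφ.isSmoothField_connection hX hY) hZ,
      hφ.extd_eq _ _ hY (hφ.isSmoothField_connection hX hZ)]
    have h2 : ∀ W : VField m M, fieldDeriv φ (fun q ↦ hφ.connection W q (X q)) p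
        = proj m φ p (mvfderiv (𝓡 (2 * m + 1)) (fieldDeriv φ W) p (X p)) := fun W ↦
      hφ.mvfderiv_connection W p (X p)
    rw [h2, h2, hφ.inner_proj (fieldDeriv_mem_derivRange φ Y p),
      hφ.inner_proj_left (fieldDeriv_mem_derivRange φ Z p), map_add]
    rfl
  torsion_horizontal X Y hX hY _ _ p := hφ.torsion_connection hT hT' hX hY p
  torsion_reeb p v hv := by
    have h : ∀ w, hφ.connection.torsion p (T p) w = 0 := fun w ↦ by
      obtain ⟨X, hX, rfl⟩ := exists_isSmoothField_eq w
      rw [hφ.torsion_connection hT hT' hT.smooth hX, hT.extd_eq_zero X hX, zero_smul]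
    rw [h, h, map_zero, neg_zero]

end PseudohermitianStructure.IsVerticalProjection

end VerticalConnection

end

/-! ### Uniqueness of the connection and vanishing of the Webster torsion -/

noncomputable section

section Uniqueness

open Bundle

variable {m n : ℕ} {M : Type*} [TopologicalSpace M] [ChartedSpace (CRModel m) M]
  [IsManifold (𝓡 (2 * m + 1)) ∞ M]

namespace PseudohermitianStructure

variable {S : PseudohermitianStructure m M}

lemma IsHorizontal.JField {X : VField m M} (hX : S.IsHorizontal X) :
    S.IsHorizontal (S.JField X) := fun p ↦ S.J_mem p _ (hX p)

lemma IsHorizontal.isSmoothField_JField {X : VField m M} (hX : S.IsHorizontal X)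
    (hs : IsSmoothField X) : IsSmoothField (S.JField X) := S.smooth_J X hs hX

namespace IsVerticalProjection

variable {φ : M → EuclideanSpace ℂ (Fin n)}

/-- Extend `v` arbitrarily, then replace each value by the horizontal vector with the same image
under `dφ`. -/
lemma exists_isHorizontal_eq [T2Space M] (hφ : S.IsVerticalProjection φ) {p : M}
    {v : TangentSpace (𝓡 (2 * m + 1)) p} (hv : S.θ p v = 0) :
    ∃ X : VField m M, IsSmoothField X ∧ S.IsHorizontal X ∧ X p = v := by
  obtain ⟨X, hX, rfl⟩ := exists_isSmoothField_eq v
  choose u hu hu' using fun q ↦ hφ.exists_eq (fieldDeriv_mem_derivRange φ X q) 0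
  refine ⟨u, ?_, hu, hφ.ext ((hu p).trans hv.symm) (hu' p)⟩
  refine hφ.isSmoothField_of_proj (hX.contMDiff_fieldDeriv hφ.smooth) contMDiff_const hu
    fun q ↦ ?_
  rw [proj_of_mem (fieldDeriv_mem_derivRange φ X q)]
  exact hu' q

variable {T : VField m M} {D : AffineConnection m M}

/-- The torsion of horizontal fields is a multiple of `T`, which `dφ` kills; so the deviation of `D`
from the flat derivative is symmetric. -/
lemma fieldDeriv_connection_comm (hφ : S.IsVerticalProjection φ)
    (hT : ∀ p, fieldDeriv φ T p = 0) (hD : S.IsPseudohermitianConnection T D) {X Y : VField m M}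
    (hX : IsSmoothField X) (hY : IsSmoothField Y) (hXh : S.IsHorizontal X)
    (hYh : S.IsHorizontal Y) (p : M) :
    fieldDeriv φ (fun q ↦ D Y q (X q)) p - fieldDeriv (fieldDeriv φ Y) X p
      = fieldDeriv φ (fun q ↦ D X q (Y q)) p - fieldDeriv (fieldDeriv φ X) Y p := by
  have h := hD.torsion_horizontal X Y hX hY hXh hYh p
  rw [D.torsion_apply (hX.mdifferentiableAt p) (hY.mdifferentiableAt p)] at h
  have h' := congrArg (mvfderiv (𝓡 (2 * m + 1)) φ p) h
  rw [map_sub, map_sub, map_smul, mvfderiv_mlieBracket_eq_fieldDeriv hφ.smooth hX hY,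
    show mvfderiv (𝓡 (2 * m + 1)) φ p (T p) = 0 from hT p, smul_zero] at h'
  rw [← sub_eq_zero, ← h']
  simp only [fieldDeriv]
  abel

/-- Since `dθ` and `J` are parallel, so is the metric `dθ(·, J ·) = 2 Re⟨dφ ·, dφ ·⟩`. The deviation
from the flat derivative is therefore skew in `Y` and `Z`. -/
lemma re_inner_fieldDeriv_connection (hφ : S.IsVerticalProjection φ)
    (hD : S.IsPseudohermitianConnection T D) {X Y Z : VField m M}
    (hX : IsSmoothField X) (hY : IsSmoothField Y) (hZ : IsSmoothField Z)
    (hYh : S.IsHorizontal Y) (hZh : S.IsHorizontal Z) (p : M) :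
    ⟪fieldDeriv φ Z p, fieldDeriv φ (fun q ↦ D Y q (X q)) p - fieldDeriv (fieldDeriv φ Y) X p⟫_ℝ
      = -⟪fieldDeriv φ Y p,
          fieldDeriv φ (fun q ↦ D Z q (X q)) p - fieldDeriv (fieldDeriv φ Z) X p⟫_ℝ := by
  have hJZ := hZh.isSmoothField_JField hZ
  have hYd := hY.mdifferentiableAt_fieldDeriv hφ.smooth p
  have hJd := hJZ.mdifferentiableAt_fieldDeriv hφ.smooth p
  have h := hD.metric X Y (S.JField Z) hX hY hJZ hYh hZh.JField p
  have h1 : (fun q ↦ extd S.θ Y (S.JField Z) q)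
      = fun q ↦ ((2 : ℝ) • Complex.imCLM) ⟪fieldDeriv φ Y q, fieldDeriv φ (S.JField Z) q⟫_ℂ :=
    funext fun q ↦ hφ.extd_eq Y _ hY hJZ q
  have h2 : (fun q ↦ D (S.JField Z) q (X q)) = S.JField (fun q ↦ D Z q (X q)) :=
    funext fun q ↦ hD.J_parallel Z hZ hZh q (X q)
  have h3 : S.IsHorizontal (fun q ↦ D Z q (X q)) := fun q ↦ hD.horizontal Z hZ hZh q _
  have h4 := hD.smooth X Z hX hZ
  rw [dirDeriv_eq_mvfderiv, h1, mvfderiv_clm_apply _ (hYd.inner_complex hJd),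
    mvfderiv_inner hYd hJd, hφ.extd_eq _ _ (hD.smooth X Y hX hY) hJZ, h2,
    hφ.extd_eq _ _ hY (h3.isSmoothField_JField h4), hφ.mvfderiv_fieldDeriv_JField hZ hZh,
    hφ.fieldDeriv_JField hZh, hφ.fieldDeriv_JField h3] at h
  simp only [inner_smul_right, ← mul_add] at h
  simp only [smul_apply, Complex.imCLM_apply, Complex.mul_im, Complex.I_re,
    Complex.I_im, smul_eq_mul, zero_mul, one_mul, zero_add] at h
  rw [real_inner_comm]
  simp only [real_inner_eq_re, inner_sub_left, inner_sub_right]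
  simp only [fieldDeriv, Complex.add_re] at h ⊢
  linarith

/-- Koszul's argument: an expression symmetric in one pair of its three arguments and skew in
another vanishes. So the deviation is orthogonal to the range. -/
lemma proj_fieldDeriv_connection [T2Space M] (hφ : S.IsVerticalProjection φ)
    (hT : ∀ p, fieldDeriv φ T p = 0) (hD : S.IsPseudohermitianConnection T D) {X Y : VField m M}
    (hX : IsSmoothField X) (hY : IsSmoothField Y) (hXh : S.IsHorizontal X)
    (hYh : S.IsHorizontal Y) (p : M) :
    mvfderiv (𝓡 (2 * m + 1)) φ p (D Y p (X p))
      = proj m φ p (mvfderiv (𝓡 (2 * m + 1)) (fieldDeriv φ Y) p (X p)) := by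
  have key : ∀ Z : VField m M, IsSmoothField Z → S.IsHorizontal Z →
      ⟪fieldDeriv φ Z p,
        fieldDeriv φ (fun q ↦ D Y q (X q)) p - fieldDeriv (fieldDeriv φ Y) X p⟫_ℝ = 0 := by
    intro Z hZ hZh
    have h1 := hφ.re_inner_fieldDeriv_connection hD hX hY hZ hYh hZh p
    have h2 := hφ.re_inner_fieldDeriv_connection hD hZ hX hY hXh hYh p
    have h3 := hφ.re_inner_fieldDeriv_connection hD hY hZ hX hZh hXh p
    rw [hφ.fieldDeriv_connection_comm hT hD hX hZ hXh hZh] at h1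
    rw [hφ.fieldDeriv_connection_comm hT hD hY hX hYh hXh] at h3
    rw [hφ.fieldDeriv_connection_comm hT hD hZ hY hZh hYh] at h2
    linarith
  rw [← sub_eq_zero]
  refine eq_zero_of_real_inner (m := m) (φ := φ) (p := p)
    (Submodule.sub_mem _ (mem_derivRange φ _) (proj_mem _ _)) fun w hw ↦ ?_
  obtain ⟨v, hv, rfl⟩ := hφ.exists_eq hw 0
  obtain ⟨Z, hZ, hZh, rfl⟩ := hφ.exists_isHorizontal_eq hv
  rw [inner_sub_right, real_inner_proj hw, ← inner_sub_right]
  exact key Z hZ hZh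

/-- Because `dφ T = 0`, the image of `Tor(T, Z)` is `dφ(D_T Z)` minus the flat derivative of `dφ Z`
along `T`. This commutes with `J`, while the axiom says that it anticommutes. -/
lemma torsion_reeb_eq_zero_and (hφ : S.IsVerticalProjection φ) (hTr : S.IsReebField T)
    (hT : ∀ p, fieldDeriv φ T p = 0) (hD : S.IsPseudohermitianConnection T D) {Y : VField m M}
    (hY : IsSmoothField Y) (hYh : S.IsHorizontal Y) (p : M) :
    D.torsion p (T p) (Y p) = 0 ∧
      mvfderiv (𝓡 (2 * m + 1)) φ p (D Y p (T p))
        = mvfderiv (𝓡 (2 * m + 1)) (fieldDeriv φ Y) p (T p) := by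
  have hTs := hTr.smooth
  have hT0 : fieldDeriv φ T = fun _ ↦ 0 := funext hT
  have hτ : ∀ Z : VField m M, IsSmoothField Z → S.IsHorizontal Z →
      S.θ p (D.torsion p (T p) (Z p)) = 0 ∧
      mvfderiv (𝓡 (2 * m + 1)) φ p (D.torsion p (T p) (Z p))
        = mvfderiv (𝓡 (2 * m + 1)) φ p (D Z p (T p))
          - mvfderiv (𝓡 (2 * m + 1)) (fieldDeriv φ Z) p (T p) := by
    intro Z hZ hZh
    rw [D.torsion_apply (hTs.mdifferentiableAt p) (hZ.mdifferentiableAt p), hD.reeb_parallel,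
      sub_zero, map_sub, map_sub, hD.horizontal Z hZ hZh]
    constructor
    · have h := hTr.extd_eq_zero Z hZ p
      have h1 : (fun q ↦ S.θ q (T q)) = fun _ ↦ (1 : ℝ) := funext hTr.θ_eq_one
      rw [extd, dirDeriv_eq_mvfderiv, dirDeriv_eq_mvfderiv, mvfderiv_θ_of_isHorizontal hZh, h1,
        mvfderiv_const, zero_apply, sub_zero] at h
      exact h
    · rw [mvfderiv_mlieBracket_eq_fieldDeriv hφ.smooth hTs hZ, hT0]
      simp only [fieldDeriv]
      rw [mvfderiv_const, zero_apply, sub_zero]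
  have h1 := hτ Y hY hYh
  have h2 := hτ (S.JField Y) (hYh.isSmoothField_JField hY) hYh.JField
  have h3 : D.torsion p (T p) (S.JField Y p) = -S.J p (D.torsion p (T p) (Y p)) :=
    hD.torsion_reeb p _ (hYh p)
  have h4 := h2.2
  rw [h3, map_neg, hφ.complex p _ h1.1, hD.J_parallel Y hY hYh,
    hφ.complex p _ (hD.horizontal Y hY hYh p _), hφ.mvfderiv_fieldDeriv_JField hY hYh,
    ← smul_sub, ← h1.2, neg_eq_iff_add_eq_zero, ← two_smul ℂ, smul_smul] at h4
  have h5 : mvfderiv (𝓡 (2 * m + 1)) φ p (D.torsion p (T p) (Y p)) = 0 :=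
    (smul_eq_zero.1 h4).resolve_left (by simp)
  refine ⟨hφ.injective p _ h1.1 h5, ?_⟩
  rw [← sub_eq_zero, ← h1.2, h5]

theorem torsion_reeb_eq_zero [T2Space M] (hφ : S.IsVerticalProjection φ)
    (hTr : S.IsReebField T) (hD : S.IsPseudohermitianConnection T D) (p : M)
    (v : TangentSpace (𝓡 (2 * m + 1)) p) : D.torsion p (T p) v = 0 := by
  have hv : S.θ p (v - S.θ p v • T p) = 0 := by simp [hTr.θ_eq_one]
  obtain ⟨Y, hY, hYh, hYp⟩ := hφ.exists_isHorizontal_eq hv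
  have h := (hφ.torsion_reeb_eq_zero_and hTr (hφ.fieldDeriv_reeb hTr) hD hY hYh p).1
  rwa [hYp, map_sub, map_smul, D.torsion_self, smul_zero, sub_zero] at h

/-- The pseudohermitian connection is the projection of the flat connection of `ℂⁿ`. -/
theorem mvfderiv_pseudohermitianConnection [T2Space M] (hφ : S.IsVerticalProjection φ)
    (hTr : S.IsReebField T) (hD : S.IsPseudohermitianConnection T D) {Y : VField m M}
    (hY : IsSmoothField Y) (hYh : S.IsHorizontal Y) (p : M)
    (v : TangentSpace (𝓡 (2 * m + 1)) p) :
    mvfderiv (𝓡 (2 * m + 1)) φ p (D Y p v)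
      = proj m φ p (mvfderiv (𝓡 (2 * m + 1)) (fieldDeriv φ Y) p v) := by
  have hT := hφ.fieldDeriv_reeb hTr
  have hv : S.θ p (v - S.θ p v • T p) = 0 := by simp [hTr.θ_eq_one]
  obtain ⟨X, hX, hXh, hXp⟩ := hφ.exists_isHorizontal_eq hv
  have h1 := hφ.proj_fieldDeriv_connection hT hD hX hY hXh hYh p
  have h2 := (hφ.torsion_reeb_eq_zero_and hTr hT hD hY hYh p).2
  -- Along `T` the flat derivative is already tangential, so projecting does not change it.
  have h3 := proj_of_mem (mem_derivRange φ (D Y p (T p)))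
  rw [h2] at h3
  have h4 : v = X p + S.θ p v • T p := by rw [hXp, sub_add_cancel]
  rw [h4]
  simp only [map_add, map_smul]
  rw [h1, h2, h3]

end IsVerticalProjection

end PseudohermitianStructure

end Uniqueness

end

/-! ### Second fundamental form and Gauss equation -/

noncomputable section

section GaussEquation

open Bundle

variable {m n : ℕ} {M : Type*} [TopologicalSpace M] [ChartedSpace (CRModel m) M]
  [IsManifold (𝓡 (2 * m + 1)) ∞ M]

namespace PseudohermitianStructure

variable {S : PseudohermitianStructure m M}

namespace IsVerticalProjection

variable {φ : M → EuclideanSpace ℂ (Fin n)} {T : VField m M} {D : AffineConnection m M}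

/-- The vector valued second fundamental form `II(X, V)` of a map to `ℂⁿ`, as the difference of
the flat derivative and the connection `D`. -/
def normalDeriv (φ : M → EuclideanSpace ℂ (Fin n)) (D : AffineConnection m M) (X V : VField m M)
    (p : M) : EuclideanSpace ℂ (Fin n) :=
  fieldDeriv (fieldDeriv φ V) X p - fieldDeriv φ (fun q ↦ D V q (X q)) p

lemma contMDiff_normalDeriv (hφ : S.IsVerticalProjection φ)
    (hD : S.IsPseudohermitianConnection T D) {X V : VField m M} (hX : IsSmoothField X)
    (hV : IsSmoothField V) :
    ContMDiff (𝓡 (2 * m + 1)) 𝓘(ℝ, EuclideanSpace ℂ (Fin n)) ∞ (normalDeriv φ D X V) :=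
  (hX.contMDiff_fieldDeriv (hV.contMDiff_fieldDeriv hφ.smooth)).sub
    ((hD.smooth X V hX hV).contMDiff_fieldDeriv hφ.smooth)

lemma mdifferentiableAt_normalDeriv (hφ : S.IsVerticalProjection φ)
    (hD : S.IsPseudohermitianConnection T D) {X V : VField m M} (hX : IsSmoothField X)
    (hV : IsSmoothField V) (p : M) :
    MDifferentiableAt (𝓡 (2 * m + 1)) 𝓘(ℝ, EuclideanSpace ℂ (Fin n)) (normalDeriv φ D X V) p :=
  (hφ.contMDiff_normalDeriv hD hX hV).mdifferentiable (by simp) p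

variable [T2Space M]

section

variable (hφ : S.IsVerticalProjection φ) (hT : S.IsReebField T)
  (hD : S.IsPseudohermitianConnection T D)
include hφ hT hD

lemma fieldDeriv_connection {X V : VField m M} (hV : IsSmoothField V) (hVh : S.IsHorizontal V)
    (p : M) : fieldDeriv φ (fun q ↦ D V q (X q)) p
      = proj m φ p (fieldDeriv (fieldDeriv φ V) X p) :=
  hφ.mvfderiv_pseudohermitianConnection hT hD hV hVh p (X p)

lemma inner_normalDeriv {X V : VField m M} (hV : IsSmoothField V) (hVh : S.IsHorizontal V)
    {p : M} {w : EuclideanSpace ℂ (Fin n)} (hw : w ∈ derivRange (m := m) φ p) :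
    ⟪w, normalDeriv φ D X V p⟫_ℂ = 0 := by
  rw [normalDeriv, hφ.fieldDeriv_connection hT hD hV hVh, inner_sub_right, hφ.inner_proj hw,
    sub_self]

lemma normalDeriv_comm {X V : VField m M} (hX : IsSmoothField X) (hXh : S.IsHorizontal X)
    (hV : IsSmoothField V) (hVh : S.IsHorizontal V) (p : M) :
    normalDeriv φ D X V p = normalDeriv φ D V X p := by
  have h := hφ.fieldDeriv_connection_comm (hφ.fieldDeriv_reeb hT) hD hX hV hXh hVh p
  rw [normalDeriv, normalDeriv, ← neg_sub, h, neg_sub]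

lemma normalDeriv_JField_right {X V : VField m M} (hV : IsSmoothField V)
    (hVh : S.IsHorizontal V) (p : M) :
    normalDeriv φ D X (S.JField V) p = Complex.I • normalDeriv φ D X V p := by
  have h := hφ.mvfderiv_fieldDeriv_JField hV hVh p (X p)
  rw [normalDeriv, normalDeriv,
    hφ.fieldDeriv_connection hT hD (hVh.isSmoothField_JField hV) hVh.JField,
    hφ.fieldDeriv_connection hT hD hV hVh, fieldDeriv, h, hφ.proj_I_smul, ← smul_sub, fieldDeriv]

/-- Linearity over `J` in the differentiated field comes from holomorphy of `φ`; symmetry carries it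
to the direction. -/
lemma normalDeriv_JField_left {X V : VField m M} (hX : IsSmoothField X)
    (hXh : S.IsHorizontal X) (hV : IsSmoothField V) (hVh : S.IsHorizontal V) (p : M) :
    normalDeriv φ D (S.JField X) V p = Complex.I • normalDeriv φ D X V p := by
  rw [hφ.normalDeriv_comm hT hD (hXh.isSmoothField_JField hX) hXh.JField hV hVh,
    hφ.normalDeriv_JField_right hT hD hX hXh, hφ.normalDeriv_comm hT hD hX hXh hV hVh]

/-- The Weingarten relation: differentiate `⟨dφ W, II(X, V)⟩ = 0` along `Y`. -/
lemma inner_fieldDeriv_normalDeriv {X Y V W : VField m M} (hX : IsSmoothField X)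
    (hV : IsSmoothField V) (hVh : S.IsHorizontal V) (hW : IsSmoothField W) (p : M) :
    ⟪fieldDeriv φ W p, fieldDeriv (normalDeriv φ D X V) Y p⟫_ℂ
      = -⟪normalDeriv φ D Y W p, normalDeriv φ D X V p⟫_ℂ := by
  have h0 : (fun q ↦ ⟪fieldDeriv φ W q, normalDeriv φ D X V q⟫_ℂ) = fun _ ↦ 0 :=
    funext fun q ↦ hφ.inner_normalDeriv hT hD hV hVh (fieldDeriv_mem_derivRange φ W q)
  have h1 := mvfderiv_inner (hW.mdifferentiableAt_fieldDeriv hφ.smooth p)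
    (hφ.mdifferentiableAt_normalDeriv hD hX hV p) (Y p)
  rw [h0, mvfderiv_const, zero_apply] at h1
  rw [normalDeriv.eq_def φ D Y W, inner_sub_left,
    hφ.inner_normalDeriv hT hD hV hVh (fieldDeriv_mem_derivRange φ _ p), sub_zero]
  exact eq_neg_of_add_eq_zero_right h1.symm

/-- Write `D` as flat derivative minus `II` inside the second covariant derivative. The flat
curvature of `dφ V` cancels by the bracket identity, leaving only derivatives of `II`. -/
lemma fieldDeriv_curvature {X Y V : VField m M} (hX : IsSmoothField X) (hY : IsSmoothField Y)
    (hV : IsSmoothField V) (hVh : S.IsHorizontal V) (p : M) :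
    fieldDeriv φ (curvature D X Y V) p
      = proj m φ p (fieldDeriv (normalDeriv φ D X V) Y p
          - fieldDeriv (normalDeriv φ D Y V) X p) := by
  have hh : ∀ Z : VField m M, S.IsHorizontal (fun q ↦ D V q (Z q)) := fun Z q ↦
    hD.horizontal V hV hVh q _
  have hb := mvfderiv_mlieBracket_eq_fieldDeriv (hV.contMDiff_fieldDeriv hφ.smooth) hX hY p
  have hsub : ∀ Z W : VField m M, IsSmoothField Z →
      fieldDeriv (normalDeriv φ D Z V) W p = fieldDeriv (fieldDeriv (fieldDeriv φ V) Z) W p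
        - fieldDeriv (fieldDeriv φ (fun q ↦ D V q (Z q))) W p := by
    intro Z W hZ
    have h1 := hZ.mdifferentiableAt_fieldDeriv (hV.contMDiff_fieldDeriv hφ.smooth) p
    have h2 := (hD.smooth Z V hZ hV).mdifferentiableAt_fieldDeriv hφ.smooth p
    exact congrArg (fun L ↦ L (W p)) (mvfderiv_sub h1 h2)
  rw [hsub X Y hX, hsub Y X hY, fieldDeriv, curvature, map_sub, map_sub,
    hφ.mvfderiv_pseudohermitianConnection hT hD (hD.smooth Y V hY hV) (hh Y),
    hφ.mvfderiv_pseudohermitianConnection hT hD (hD.smooth X V hX hV) (hh X),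
    hφ.mvfderiv_pseudohermitianConnection hT hD hV hVh, hb, ← map_sub, ← map_sub]
  congr 1
  simp only [fieldDeriv]
  abel

/-- Needed because the formula for `dθ`, hence for the Levi form, is available for smooth fields. -/
lemma isSmoothField_curvature {X Y V : VField m M} (hX : IsSmoothField X) (hY : IsSmoothField Y)
    (hV : IsSmoothField V) (hVh : S.IsHorizontal V) : IsSmoothField (curvature D X Y V) := by
  refine hφ.isSmoothField_of_proj (c := fun _ ↦ 0)
    ((hY.contMDiff_fieldDeriv (hφ.contMDiff_normalDeriv hD hX hV)).sub
      (hX.contMDiff_fieldDeriv (hφ.contMDiff_normalDeriv hD hY hV))) contMDiff_const (fun p ↦ ?_)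
    (hφ.fieldDeriv_curvature hT hD hX hY hV hVh)
  have hh : ∀ Z : VField m M, S.IsHorizontal (fun q ↦ D V q (Z q)) := fun Z q ↦
    hD.horizontal V hV hVh q _
  rw [curvature, map_sub, map_sub, hD.horizontal _ (hD.smooth Y V hY hV) (hh Y),
    hD.horizontal _ (hD.smooth X V hX hV) (hh X), hD.horizontal V hV hVh, sub_self, sub_self]

omit [T2Space M] hT hD in
lemma levi_eq_inner {V W : VField m M} (hV : IsSmoothField V) (hW : IsSmoothField W)
    (hWh : S.IsHorizontal W) (p : M) :
    S.levi V W p = ⟪fieldDeriv φ W p, fieldDeriv φ V p⟫_ℂ := by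
  rw [levi, hφ.extd_eq V W hV hW, hφ.extd_eq V _ hV (hWh.isSmoothField_JField hW),
    hφ.fieldDeriv_JField hWh, inner_smul_right, ← inner_conj_symm (fieldDeriv φ W p)]
  generalize ⟪fieldDeriv φ V p, fieldDeriv φ W p⟫_ℂ = z
  refine Complex.ext (by simp) ?_
  simp
  ring

lemma levi_curvature {X Y V W : VField m M} (hX : IsSmoothField X) (hY : IsSmoothField Y)
    (hV : IsSmoothField V) (hVh : S.IsHorizontal V) (hW : IsSmoothField W)
    (hWh : S.IsHorizontal W) (p : M) :
    S.levi (curvature D X Y V) W p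
      = ⟪normalDeriv φ D X W p, normalDeriv φ D Y V p⟫_ℂ
        - ⟪normalDeriv φ D Y W p, normalDeriv φ D X V p⟫_ℂ := by
  rw [hφ.levi_eq_inner (hφ.isSmoothField_curvature hT hD hX hY hV hVh) hW hWh,
    hφ.fieldDeriv_curvature hT hD hX hY hV hVh, hφ.inner_proj (fieldDeriv_mem_derivRange φ W p),
    inner_sub_right, hφ.inner_fieldDeriv_normalDeriv hT hD hX hV hVh hW,
    hφ.inner_fieldDeriv_normalDeriv hT hD hY hV hVh hW]
  ring

/-- The Gauss equation of a vertical projection. -/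
theorem websterCurvature_eq {X Y V W : VField m M} (hX : IsSmoothField X)
    (hXh : S.IsHorizontal X) (hY : IsSmoothField Y) (hYh : S.IsHorizontal Y)
    (hV : IsSmoothField V) (hVh : S.IsHorizontal V) (hW : IsSmoothField W)
    (hWh : S.IsHorizontal W) (p : M) :
    S.websterCurvature D V W X Y p
      = -⟪normalDeriv φ D Y W p, normalDeriv φ D X V p⟫_ℂ := by
  have hJX := hXh.isSmoothField_JField hX
  have hJY := hYh.isSmoothField_JField hY
  rw [websterCurvature, hφ.levi_curvature hT hD hX hY hV hVh hW hWh,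
    hφ.levi_curvature hT hD hJX hJY hV hVh hW hWh, hφ.levi_curvature hT hD hX hJY hV hVh hW hWh,
    hφ.levi_curvature hT hD hJX hY hV hVh hW hWh]
  simp only [hφ.normalDeriv_JField_left hT hD hX hXh hV hVh,
    hφ.normalDeriv_JField_left hT hD hX hXh hW hWh, hφ.normalDeriv_JField_left hT hD hY hYh hV hVh,
    hφ.normalDeriv_JField_left hT hD hY hYh hW hWh, inner_smul_left, inner_smul_right,
    Complex.conj_I]
  -- The product `⟨II(X, W), II(Y, V)⟩` is conjugate linear in `X` and linear in `Y`, so it vanishes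
  -- on `(Z_X, conj Z_Y)`. The other product has the opposite types and is reproduced unchanged.
  linear_combination (1 / 4 * ⟪normalDeriv φ D X W p, normalDeriv φ D Y V p⟫_ℂ
    + 3 / 4 * ⟪normalDeriv φ D Y W p, normalDeriv φ D X V p⟫_ℂ) * Complex.I_mul_I

end

end IsVerticalProjection

end PseudohermitianStructure

end GaussEquation

end

/-! ### Vertical submanifolds of the Heisenberg group -/

noncomputable section

section HeisenbergSubmanifold

open Bundle

variable {m n : ℕ} {M : Type*} [TopologicalSpace M] [ChartedSpace (CRModel m) M]

lemma Heis.contactForm_eq (q v : Heis n) : Heis.contactForm q v = v.2 + (⟪q.1, v.1⟫_ℂ).im := by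
  simp only [Heis.contactForm, PiLp.inner_apply, RCLike.inner_apply, Complex.im_sum]
  congr 1
  refine Finset.sum_congr rfl fun β _ ↦ ?_
  simp
  ring

lemma pushforward_fst {ι : M → Heis n} {p : M}
    (hι : MDifferentiableAt (𝓡 (2 * m + 1)) 𝓘(ℝ, Heis n) ι p)
    (v : TangentSpace (𝓡 (2 * m + 1)) p) :
    (pushforward ι p v).1 = mvfderiv (𝓡 (2 * m + 1)) (fun q ↦ (ι q).1) p v :=
  (mvfderiv_clm_apply (ContinuousLinearMap.fst ℝ (EuclideanSpace ℂ (Fin n)) ℝ) hι v).symm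

lemma pushforward_snd {ι : M → Heis n} {p : M}
    (hι : MDifferentiableAt (𝓡 (2 * m + 1)) 𝓘(ℝ, Heis n) ι p)
    (v : TangentSpace (𝓡 (2 * m + 1)) p) :
    (pushforward ι p v).2 = mvfderiv (𝓡 (2 * m + 1)) (fun q ↦ (ι q).2) p v :=
  (mvfderiv_clm_apply (ContinuousLinearMap.snd ℝ (EuclideanSpace ℂ (Fin n)) ℝ) hι v).symm

variable [IsManifold (𝓡 (2 * m + 1)) ∞ M]

namespace PseudohermitianStructure

variable {S : PseudohermitianStructure m M}

namespace IsPseudohermitianSubmanifold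

variable {ι : M → Heis n} (hι : S.IsPseudohermitianSubmanifold ι)
include hι

lemma contMDiff_fst :
    ContMDiff (𝓡 (2 * m + 1)) 𝓘(ℝ, EuclideanSpace ℂ (Fin n)) ∞ (fun q ↦ (ι q).1) :=
  (ContinuousLinearMap.fst ℝ (EuclideanSpace ℂ (Fin n)) ℝ).contDiff.contMDiff.comp hι.smooth

lemma contMDiff_snd : ContMDiff (𝓡 (2 * m + 1)) 𝓘(ℝ, ℝ) ∞ (fun q ↦ (ι q).2) :=
  (ContinuousLinearMap.snd ℝ (EuclideanSpace ℂ (Fin n)) ℝ).contDiff.contMDiff.comp hι.smooth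

lemma pushforward_fst_eq (p : M) (v : TangentSpace (𝓡 (2 * m + 1)) p) :
    (pushforward ι p v).1 = mvfderiv (𝓡 (2 * m + 1)) (fun q ↦ (ι q).1) p v :=
  pushforward_fst (hι.smooth.mdifferentiable (by simp) p) v

lemma θ_eq (p : M) (v : TangentSpace (𝓡 (2 * m + 1)) p) :
    S.θ p v = mvfderiv (𝓡 (2 * m + 1)) (fun q ↦ (ι q).2) p v
      + Complex.imCLM ⟪(ι p).1, mvfderiv (𝓡 (2 * m + 1)) (fun q ↦ (ι q).1) p v⟫_ℂ := by
  have h := hι.smooth.mdifferentiable (by simp) p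
  rw [hι.form, Heis.contactForm_eq, pushforward_fst h, pushforward_snd h]
  rfl

/-- In `θ = dt + Im⟨z, dz⟩` the second derivatives cancel against `θ([X, Y])`. The remaining
products of first derivatives add up by conjugate symmetry, whence the factor 2. -/
lemma extd_eq {X Y : VField m M} (hX : IsSmoothField X) (hY : IsSmoothField Y) (p : M) :
    extd S.θ X Y p = 2 * (⟪fieldDeriv (fun q ↦ (ι q).1) X p,
      fieldDeriv (fun q ↦ (ι q).1) Y p⟫_ℂ).im := by
  have key : ∀ Z W : VField m M, IsSmoothField Z →
      dirDeriv (fun q ↦ S.θ q (Z q)) p (W p)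
        = fieldDeriv (fieldDeriv (fun q ↦ (ι q).2) Z) W p
          + (⟪fieldDeriv (fun q ↦ (ι q).1) W p, fieldDeriv (fun q ↦ (ι q).1) Z p⟫_ℂ).im
          + (⟪(ι p).1, fieldDeriv (fieldDeriv (fun q ↦ (ι q).1) Z) W p⟫_ℂ).im := by
    intro Z W hZ
    have h1 : (fun q ↦ S.θ q (Z q)) = fun q ↦ fieldDeriv (fun q ↦ (ι q).2) Z q
        + Complex.imCLM ⟪(ι q).1, fieldDeriv (fun q ↦ (ι q).1) Z q⟫_ℂ :=
      funext fun q ↦ hι.θ_eq q (Z q)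
    have hφ := hι.contMDiff_fst.mdifferentiable (by simp) p
    have hφZ := hZ.mdifferentiableAt_fieldDeriv hι.contMDiff_fst p
    have hin := hφ.inner_complex hφZ
    have him : MDifferentiableAt (𝓡 (2 * m + 1)) 𝓘(ℝ, ℝ)
        (fun q ↦ Complex.imCLM ⟪(ι q).1, fieldDeriv (fun q ↦ (ι q).1) Z q⟫_ℂ) p :=
      Complex.imCLM.differentiableAt.mdifferentiableAt.comp p hin
    rw [dirDeriv_eq_mvfderiv, h1,
      mvfderiv_fun_add (hZ.mdifferentiableAt_fieldDeriv hι.contMDiff_snd p) him, add_apply,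
      mvfderiv_clm_apply _ hin, mvfderiv_inner hφ hφZ, map_add, ← add_assoc]
    rfl
  rw [extd, key Y X hY, key X Y hX, hι.θ_eq,
    mvfderiv_mlieBracket_eq_fieldDeriv hι.contMDiff_fst hX hY,
    mvfderiv_mlieBracket_eq_fieldDeriv hι.contMDiff_snd hX hY, inner_sub_right, map_sub,
    ← inner_conj_symm (fieldDeriv (fun q ↦ (ι q).1) Y p) (fieldDeriv (fun q ↦ (ι q).1) X p)]
  simp only [Complex.imCLM_apply, Complex.conj_im]
  ring

/-- The projection to `ℂⁿ` of a vertical pseudohermitian submanifold. -/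
theorem isVerticalProjection (hν : S.IsVertical ι) :
    S.IsVerticalProjection (fun q ↦ (ι q).1) where
  smooth := hι.contMDiff_fst
  complex p v hv := by
    rw [← hι.pushforward_fst_eq, hι.complex p v hv, ← hι.pushforward_fst_eq]
    rfl
  injective p v hv h := by
    apply hι.immersion p
    rw [← hι.pushforward_fst_eq] at h
    rw [hι.form, Heis.contactForm_eq, h, inner_zero_right, Complex.zero_im, add_zero] at hv
    rw [map_zero]
    exact Prod.ext h hv
  exists_transverse p := by
    -- Verticality enters here: `T` itself is tangent to `M`, and its `ℂⁿ`-part is zero.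
    obtain ⟨v, hv⟩ := hν.tangent p
    rw [add_zero] at hv
    refine ⟨v, ?_, ?_⟩
    · rw [hι.form, hv, Heis.contactForm_eq]
      simp [Heis.T]
    · rw [← hι.pushforward_fst_eq, hv]
      rfl
  contMDiffAt_θ X p hX := by
    have h1 : (fun q ↦ S.θ q (X q)) = fun q ↦ mvfderiv (𝓡 (2 * m + 1)) (fun q ↦ (ι q).2) q (X q)
        + Complex.imCLM ⟪(ι q).1, mvfderiv (𝓡 (2 * m + 1)) (fun q ↦ (ι q).1) q (X q)⟫_ℂ :=
      funext fun q ↦ hι.θ_eq q (X q)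
    rw [h1]
    have h2 := (hι.contMDiff_fst p).inner_complex
      (ContMDiffAt.mvfderiv_vectorField hι.contMDiff_fst hX)
    exact (ContMDiffAt.mvfderiv_vectorField hι.contMDiff_snd hX).add
      (Complex.imCLM.contDiff.contMDiff.contMDiffAt.comp p h2)
  mdifferentiableAt_θ X p hX := by
    have h1 : (fun q ↦ S.θ q (X q)) = fun q ↦ mvfderiv (𝓡 (2 * m + 1)) (fun q ↦ (ι q).2) q (X q)
        + Complex.imCLM ⟪(ι q).1, mvfderiv (𝓡 (2 * m + 1)) (fun q ↦ (ι q).1) q (X q)⟫_ℂ :=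
      funext fun q ↦ hι.θ_eq q (X q)
    rw [h1]
    have h2 := (hι.contMDiff_fst.mdifferentiable (by simp) p).inner_complex
      (MDifferentiableAt.mvfderiv_vectorField hι.contMDiff_fst hX)
    exact (MDifferentiableAt.mvfderiv_vectorField hι.contMDiff_snd hX).add
      (Complex.imCLM.differentiableAt.mdifferentiableAt.comp p h2)
  extd_eq X Y hX hY p := hι.extd_eq hX hY p

/-- The `ℂⁿ`-coefficients in the left invariant frame are the components of `dφ Y`; the frame being
parallel, their derivative is the flat one. -/
lemma heisDeriv_fst {Y : VField m M} (hY : IsSmoothField Y) (p : M)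
    (v : TangentSpace (𝓡 (2 * m + 1)) p) :
    (heisDeriv ι (fun q ↦ pushforward ι q (Y q)) p v).1
      = mvfderiv (𝓡 (2 * m + 1)) (fieldDeriv (fun q ↦ (ι q).1) Y) p v := by
  have h1 : (fun q ↦ Heis.coeff (ι q) (pushforward ι q (Y q)))
      = fun q ↦ (fieldDeriv (fun q ↦ (ι q).1) Y q, S.θ q (Y q)) := by
    funext q
    rw [Heis.coeff, ← hι.form, hι.pushforward_fst_eq]
    rfl
  have h2 := mvfderiv_prodMk (hY.mdifferentiableAt_fieldDeriv hι.contMDiff_fst p)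
    ((S.smooth_θ Y hY).mdifferentiable (by simp) p) v
  rw [heisDeriv, h1]
  exact congrArg Prod.fst h2

lemma contactSubspace_eq (hν : S.IsVertical ι) (p : M) :
    S.contactSubspace ι p = derivRange (m := m) (fun q ↦ (ι q).1) p := by
  ext w
  constructor
  · rintro ⟨v, -, rfl⟩
    exact ⟨v, (hι.pushforward_fst_eq p v).symm⟩
  · intro hw
    obtain ⟨v, hv, rfl⟩ := (hι.isVerticalProjection hν).exists_eq hw 0
    exact ⟨v, hv, hι.pushforward_fst_eq p v⟩

theorem pushforward_pseudohermitianConnection [T2Space M] (hν : S.IsVertical ι) {T : VField m M}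
    {D : AffineConnection m M} (hT : S.IsReebField T) (hD : S.IsPseudohermitianConnection T D)
    {Y : VField m M} (hY : IsSmoothField Y) (hYh : S.IsHorizontal Y) (p : M)
    (v : TangentSpace (𝓡 (2 * m + 1)) p) :
    pushforward ι p (D Y p v) = S.tangentialDeriv ι Y p v := by
  have h := (hι.isVerticalProjection hν).mvfderiv_pseudohermitianConnection hT hD hY hYh p v
  rw [← Heis.frame_coeff (ι p) (pushforward ι p (D Y p v)), Heis.coeff, ← hι.form,
    hD.horizontal Y hY hYh, hι.pushforward_fst_eq, h, tangentialDeriv, hι.heisDeriv_fst hY]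
  simp only [hι.contactSubspace_eq hν]
  rfl

/-- A normal `N` does not see the tangential part, and complex linearity of `II` in the direction
makes evaluation at `Z_k` the same as at `Y`. -/
lemma secondFundamentalForm_eq [T2Space M] (hν : S.IsVertical ι) {T : VField m M}
    {D : AffineConnection m M} (hT : S.IsReebField T) (hD : S.IsPseudohermitianConnection T D)
    {X Y : VField m M} (hX : IsSmoothField X) (hXh : S.IsHorizontal X) (hY : IsSmoothField Y)
    (hYh : S.IsHorizontal Y) {p : M} {N : EuclideanSpace ℂ (Fin n)}
    (hN : ∀ w ∈ derivRange (m := m) (fun q ↦ (ι q).1) p, ⟪N, w⟫_ℂ = 0) :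
    S.secondFundamentalForm ι N X Y p
      = ⟪N, IsVerticalProjection.normalDeriv (fun q ↦ (ι q).1) D Y X p⟫_ℂ := by
  have hφ := hι.isVerticalProjection hν
  have h1 : ∀ Z : VField m M, connectionForm ι N X p (Z p)
      = ⟪N, IsVerticalProjection.normalDeriv (fun q ↦ (ι q).1) D Z X p⟫_ℂ := fun Z ↦ by
    rw [connectionForm, hι.heisDeriv_fst hX, IsVerticalProjection.normalDeriv, inner_sub_right,
      hN _ (IsVerticalProjection.fieldDeriv_mem_derivRange _ _ p), sub_zero]
    rfl
  have h2 : connectionForm ι N X p (S.J p (Y p)) = _ := h1 (S.JField Y)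
  rw [secondFundamentalForm, h1, h2, hφ.normalDeriv_JField_left hT hD hY hYh hX hXh,
    inner_smul_right, ← mul_assoc, Complex.I_mul_I]
  ring

end IsPseudohermitianSubmanifold

namespace IsVerticalProjection

variable {φ : M → EuclideanSpace ℂ (Fin n)}

/-- The collapsed transverse vector costs one of the `2m + 1` dimensions. -/
lemma finrank_derivRange_le (hφ : S.IsVerticalProjection φ) (p : M) :
    Module.finrank ℝ (derivRange (m := m) φ p) ≤ 2 * m := by
  have : FiniteDimensional ℝ (TangentSpace (𝓡 (2 * m + 1)) p) :=
    inferInstanceAs (FiniteDimensional ℝ (CRModel m))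
  have h1 : Module.finrank ℝ (TangentSpace (𝓡 (2 * m + 1)) p) = 2 * m + 1 :=
    finrank_euclideanSpace_fin (𝕜 := ℝ)
  have h2 := LinearMap.finrank_range_add_finrank_ker (mvfderiv (𝓡 (2 * m + 1)) φ p).toLinearMap
  obtain ⟨t, ht, ht'⟩ := hφ.exists_transverse p
  have h3 : 0 < Module.finrank ℝ (LinearMap.ker (mvfderiv (𝓡 (2 * m + 1)) φ p).toLinearMap) := by
    rw [Module.finrank_pos_iff_exists_ne_zero]
    refine ⟨⟨t, ht'⟩, fun h ↦ ?_⟩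
    have h0 : t = 0 := congrArg Subtype.val h
    rw [h0, map_zero] at ht
    exact zero_ne_one ht
  rw [h1] at h2
  have h4 : Module.finrank ℝ (derivRange (m := m) φ p)
    = Module.finrank ℝ (LinearMap.range (mvfderiv (𝓡 (2 * m + 1)) φ p).toLinearMap) := rfl
  omega

/-- The range is a complex subspace of real dimension at most `2m`, so `m` complex independent
vectors fill it. -/
lemma mem_span_of_linearIndependent (hφ : S.IsVerticalProjection φ) {p : M}
    {w : Fin m → EuclideanSpace ℂ (Fin n)} (hw : ∀ j, w j ∈ derivRange (m := m) φ p)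
    (hli : LinearIndependent ℂ w) {x : EuclideanSpace ℂ (Fin n)}
    (hx : x ∈ derivRange (m := m) φ p) : x ∈ Submodule.span ℂ (Set.range w) := by
  let W : Submodule ℂ (EuclideanSpace ℂ (Fin n)) :=
    { carrier := derivRange (m := m) φ p
      add_mem' := Submodule.add_mem _
      zero_mem' := Submodule.zero_mem _
      smul_mem' := fun c y hy ↦ by
        have h : c • y = c.re • y + c.im • (Complex.I • y) := by
          conv_lhs => rw [← Complex.re_add_im c]
          rw [add_smul, mul_smul]
          rfl
        rw [h]
        exact Submodule.add_mem _ (Submodule.smul_mem _ _ hy)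
          (Submodule.smul_mem _ _ (hφ.I_smul_mem hy)) }
  have h1 : Module.finrank ℝ W ≤ 2 * m := hφ.finrank_derivRange_le p
  have h2 := Module.finrank_mul_finrank ℝ ℂ W
  rw [Complex.finrank_real_complex] at h2
  have h3 := finrank_span_eq_card hli
  rw [Fintype.card_fin] at h3
  have h4 : Submodule.span ℂ (Set.range w) = W :=
    Submodule.eq_of_le_of_finrank_le (Submodule.span_le.2 (by rintro _ ⟨j, rfl⟩; exact hw j))
      (by omega)
  rw [h4]
  exact hx

end IsVerticalProjection

end PseudohermitianStructure

lemma Orthonormal.sum_inner_mul_inner_of_card {ι V : Type*} [Fintype ι] [NormedAddCommGroup V]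
    [InnerProductSpace ℂ V] [FiniteDimensional ℂ V] {b : ι → V} (hb : Orthonormal ℂ b)
    (hc : Module.finrank ℂ V ≤ Fintype.card ι) (x y : V) :
    ∑ i, ⟪x, b i⟫_ℂ * ⟪b i, y⟫_ℂ = ⟪x, y⟫_ℂ := by
  have hcard := le_antisymm hb.linearIndependent.fintype_card_le_finrank hc
  have hsp := hb.linearIndependent.span_eq_top_of_card_eq_finrank' hcard
  simpa using (OrthonormalBasis.mk hb hsp.ge).sum_inner_mul_inner x y

end HeisenbergSubmanifold

end

/-! ### The theorem for vertical submanifolds -/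

theorem theoremE (m n : ℕ) (hm : 1 ≤ m) (M : Type*) [TopologicalSpace M] [T2Space M]
    [ChartedSpace (CRModel m) M] [IsManifold (𝓡 (2 * m + 1)) ∞ M]
    (S : PseudohermitianStructure m M) (ι : M → Heis n)
    (hι : S.IsPseudohermitianSubmanifold ι) (hν : S.IsVertical ι) :
    (∃ (T : VField m M) (D : AffineConnection m M),
      S.IsReebField T ∧ S.IsPseudohermitianConnection T D) ∧
    ∀ (T : VField m M) (D : AffineConnection m M),
      S.IsReebField T → S.IsPseudohermitianConnection T D →
      -- the Webster torsion vanishes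
      (∀ p v, D.torsion p (T p) v = 0) ∧
      -- the pseudohermitian connection is the tangential connection
      (∀ Y : VField m M, IsSmoothField Y → S.IsHorizontal Y →
        ∀ p v, pushforward ι p (D Y p v) = S.tangentialDeriv ι Y p v) ∧
      -- the Gauss-like equation and the formula for the Webster-Ricci tensor
      (∀ p E N, S.IsDarbouxFrameAt ι p E N →
        (∀ j l ζ η, S.websterCurvature D (E j) (E l) (E ζ) (E η) p =
          -∑ c, S.secondFundamentalForm ι (N c) (E j) (E ζ) p *
            (starRingEnd ℂ) (S.secondFundamentalForm ι (N c) (E l) (E η) p)) ∧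
        (∀ ζ η, S.websterRicci D E (E ζ) (E η) p =
          -∑ c, ∑ k, S.secondFundamentalForm ι (N c) (E k) (E ζ) p *
            (starRingEnd ℂ) (S.secondFundamentalForm ι (N c) (E k) (E η) p))) ∧
      -- the Webster-Ricci tensor is non-positive
      (∀ p E, S.IsUnitaryFrameAt p E → ∀ X : VField m M, IsSmoothField X → S.IsHorizontal X →
        (S.websterRicci D E X X p).im = 0 ∧ (S.websterRicci D E X X p).re ≤ 0) := by
  have hφ := hι.isVerticalProjection hν
  refine ⟨?_, fun T D hT hD ↦ ⟨hφ.torsion_reeb_eq_zero hT hD,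
    fun Y hY hYh p v ↦ hι.pushforward_pseudohermitianConnection hν hT hD hY hYh p v, ?_, ?_⟩⟩
  · obtain ⟨T, hT, hT'⟩ := hφ.exists_isReebField
    exact ⟨T, hφ.connection, hT, hφ.isPseudohermitianConnection hT hT'⟩
  · intro p E N hEN
    have hmem : ∀ j, (pushforward ι p (E j p)).1
        ∈ derivRange (m := m) (fun q ↦ (ι q).1) p := fun j ↦
      ⟨E j p, (hι.pushforward_fst_eq p (E j p)).symm⟩
    have hli : LinearIndependent ℂ (fun j ↦ (pushforward ι p (E j p)).1) :=
      hEN.unitary.linearIndependent.comp Sum.inl Sum.inl_injective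
    -- The tangential frame vectors span the range over `ℂ`, so orthogonality to them suffices.
    have hN : ∀ c, ∀ w ∈ derivRange (m := m) (fun q ↦ (ι q).1) p, ⟪N c, w⟫_ℂ = 0 := by
      intro c w hw
      have hs := hφ.mem_span_of_linearIndependent hmem hli hw
      clear hw
      induction hs using Submodule.span_induction with
      | mem x hx =>
        obtain ⟨j, rfl⟩ := hx
        exact hEN.unitary.inner_eq_zero (i := Sum.inr c) (j := Sum.inl j) (by simp)
      | zero => exact inner_zero_right _
      | add x y _ _ hx hy => rw [inner_add_right, hx, hy, add_zero]
      | smul a x _ hx => rw [inner_smul_right, hx, mul_zero]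
    have hgauss : ∀ j l ζ η, S.websterCurvature D (E j) (E l) (E ζ) (E η) p =
        -∑ c, S.secondFundamentalForm ι (N c) (E j) (E ζ) p *
          (starRingEnd ℂ) (S.secondFundamentalForm ι (N c) (E l) (E η) p) := by
      intro j l ζ η
      have hE := hEN.smooth
      have hEh := hEN.horizontal
      -- Parseval in the Darboux frame. The count `n ≤ m + (n - m)` holds even for truncated
      -- subtraction, and the tangential terms vanish because `II` is normal.
      rw [hφ.websterCurvature_eq hT hD (hE ζ) (hEh ζ) (hE η) (hEh η) (hE j) (hEh j) (hE l) (hEh l),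
        ← hEN.unitary.sum_inner_mul_inner_of_card (by simp; omega), Fintype.sum_sum_type]
      congr 1
      rw [Finset.sum_eq_zero, zero_add]
      · refine Finset.sum_congr rfl fun c _ ↦ ?_
        rw [hι.secondFundamentalForm_eq hν hT hD (hE j) (hEh j) (hE ζ) (hEh ζ) (hN c),
          hι.secondFundamentalForm_eq hν hT hD (hE l) (hEh l) (hE η) (hEh η) (hN c),
          inner_conj_symm, mul_comm]
        rfl
      · intro k _
        have h := hφ.inner_normalDeriv hT hD (X := E ζ) (hE j) (hEh j) (hmem k)
        rw [Sum.elim_inl, h, mul_zero]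
    refine ⟨hgauss, fun ζ η ↦ ?_⟩
    rw [Finset.sum_comm, PseudohermitianStructure.websterRicci, ← Finset.sum_neg_distrib]
    exact Finset.sum_congr rfl fun k _ ↦ hgauss k k ζ η
  · intro p E hE X hX hXh
    rw [PseudohermitianStructure.websterRicci, Complex.im_sum, Complex.re_sum]
    -- On the diagonal the Gauss equation gives minus the squared norm of `II(X, E_k)`.
    have h : ∀ k, S.websterCurvature D (E k) (E k) X X p = _ := fun k ↦
      hφ.websterCurvature_eq hT hD hX hXh hX hXh (hE.smooth k) (hE.horizontal k) (hE.smooth k)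
        (hE.horizontal k) p
    refine ⟨Finset.sum_eq_zero fun k _ ↦ ?_, Finset.sum_nonpos fun k _ ↦ ?_⟩
    · rw [h k, Complex.neg_im, neg_eq_zero]
      exact inner_self_im (𝕜 := ℂ) _
    · rw [h k, Complex.neg_re, neg_nonpos]
      exact inner_self_nonneg (𝕜 := ℂ)
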